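/- Throughout, $T\subseteq\mathbb R^n$, $d$ is the Euclidean metric, $\beta(s,t,u)$ means $d(s,u)=d(s,t)+d(t,u)$, and $(T,\beta)$ is the set $T$ with $\beta$ restricted to $T$. Three points are collinear if $\beta$ holds of them in some order. A line in $T$ is a set $L\subseteq T$ with at least two points, any three of which are collinear, such that for all $s\ne t$ in $L$ every $u\in T$ with $\beta(s,u,t)$ or $\beta(s,t,u)$ is in $L$. An $m$-dimensional flat is a translate of the span of $m$ linearly independent vectors of $\mathbb R^n$. A set $U\subseteq\mathbb R^n$ is a linearly regular $m$-dimensional flat if (1) $U$ is contained in an $m$-dimensional flat; (2) $U$ is not contained in an $(m-1)$-dimensional flat; (3) every line $L$ in $U$ is dense in the line of $\mathbb R^n$ that contains $L$; (4) whenever $L_1\neq L_2$ are lines in $U$ such that the lines of $\mathbb R^n$ containing them have a common point, $L_1\cap L_2\neq\emptyset$. The set $T$ extends linearly in $m$D if there are a linearly regular $m$-dimensional flat $S$, a real $\varepsilon>0$ and a point $x\in S\cap T$ with $\{u\in S: d(x,u)<\varepsilon\}\subseteq T$. A monadic $\Pi^1_1$-sentence over $\{\beta\}$ is $\forall X_0\cdots\forall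 X_{k-1}\,\varphi$ with $k\ge 0$ and $\varphi$ a first-order sentence (with equality) of the vocabulary $\{\beta,X_0,\dots,X_{k-1}\}$, where the $X_i$ are unary. The weak monadic $\Pi^1_1$-theory of $(T,\beta)$ is the set of those monadic $\Pi^1_1$-sentences that are true in $(T,\beta)$ when the $X_i$ range over the finite subsets of $T$. Sentences are identified with their Gödel numbers. A set of sentences is $\Pi^0_1$-hard if every set of natural numbers with recursively enumerable complement is many-one reducible to it by a computable function. **Theorem.** Let $T\subseteq\mathbb R^n$ extend linearly in $2$D. Then the weak monadic $\Pi^1_1$-theory of $(T,\beta)$ is $\Pi^0_1$-hard. Moreover, the first-order theory of the class of all expansions $(T,\beta,(P_i)_{i\in\mathbb N})$ of $(T,\beta)$ by finite unary predicates $P_i\subseteq T$ (the set of first-order sentences of the vocabulary $\{\beta\}\cup\{P_i : i\in\mathbb N\}$ that are true in all these structures) is undecidable. -/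

import Mathlib

namespace BetweennessTheories

/-! ### Betweenness, lines, flats, and sets extending linearly in `m` dimensions -/

/-- Euclidean betweenness: `t` lies between `s` and `u`, end points allowed. -/
def Betw {n : ℕ} (s t u : EuclideanSpace ℝ (Fin n)) : Prop :=
  dist s u = dist s t + dist t u

def CollinearTriple {n : ℕ} (s t u : EuclideanSpace ℝ (Fin n)) : Prop :=
  Betw s t u ∨ Betw s u t ∨ Betw t s u

/-- `L` is a line in `T`. For `T = Set.univ` these are the lines of `ℝⁿ`. -/
structure IsLineIn {n : ℕ} (T L : Set (EuclideanSpace ℝ (Fin n))) : Prop where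
  subset : L ⊆ T
  exists_ne : ∃ s ∈ L, ∃ t ∈ L, s ≠ t
  collinear : ∀ s ∈ L, ∀ t ∈ L, ∀ u ∈ L, CollinearTriple s t u
  mem_of_betw : ∀ s ∈ L, ∀ t ∈ L, s ≠ t → ∀ u ∈ T, Betw s u t ∨ Betw s t u → u ∈ L

/-- The lines `L₁` and `L₂` are distinct and the lines of `ℝⁿ` that contain them meet. -/
def IntersectInSpace {n : ℕ} (L₁ L₂ : Set (EuclideanSpace ℝ (Fin n))) : Prop :=
  L₁ ≠ L₂ ∧ ∃ L₁' L₂' : Set (EuclideanSpace ℝ (Fin n)),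
    IsLineIn Set.univ L₁' ∧ IsLineIn Set.univ L₂' ∧ L₁ ⊆ L₁' ∧ L₂ ⊆ L₂' ∧ (L₁' ∩ L₂').Nonempty

/-- An `m`-dimensional flat: a translate of the span of `m` linearly independent vectors. -/
def IsFlat {n : ℕ} (m : ℕ) (S : Set (EuclideanSpace ℝ (Fin n))) : Prop :=
  ∃ (v : Fin m → EuclideanSpace ℝ (Fin n)) (h : EuclideanSpace ℝ (Fin n)),
    LinearIndependent ℝ v ∧ S = {u | ∃ r : Fin m → ℝ, u = h + ∑ i, r i • v i}

/-- Every line in `U` is dense in the line of `ℝⁿ` that contains it. -/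
def LinearlyComplete {n : ℕ} (U : Set (EuclideanSpace ℝ (Fin n))) : Prop :=
  ∀ L L' : Set (EuclideanSpace ℝ (Fin n)), IsLineIn U L → IsLineIn Set.univ L' → L ⊆ L' →
    ∀ r ∈ L', ∀ ε : ℝ, 0 < ε → ∃ s ∈ L, dist s r < ε

/-- Lines in `U` that intersect in `ℝⁿ` intersect in `U`. -/
def LinearlyClosed {n : ℕ} (U : Set (EuclideanSpace ℝ (Fin n))) : Prop :=
  ∀ L₁ L₂ : Set (EuclideanSpace ℝ (Fin n)), IsLineIn U L₁ → IsLineIn U L₂ →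
    IntersectInSpace L₁ L₂ → ∃ s ∈ U, s ∈ L₁ ∩ L₂

/-- `U` is a linearly regular `m`-dimensional flat. (For `m = 0` there is no flat of dimension
`m - 1`, so the second condition is void.) -/
structure IsLinearlyRegularFlat {n : ℕ} (m : ℕ) (U : Set (EuclideanSpace ℝ (Fin n))) : Prop where
  subset_flat : ∃ S : Set (EuclideanSpace ℝ (Fin n)), IsFlat m S ∧ U ⊆ S
  not_subset_flat : ∀ k : ℕ, k + 1 = m →
    ¬ ∃ S : Set (EuclideanSpace ℝ (Fin n)), IsFlat k S ∧ U ⊆ S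
  linearlyComplete : LinearlyComplete U
  linearlyClosed : LinearlyClosed U

/-- `T` extends linearly in `mD`: it contains all points of some linearly regular `m`-dimensional
flat `S` that are close to some point `x ∈ S ∩ T`. (The condition `m ≤ n` is automatic, by linear
independence.) -/
def ExtendsLinearly {n : ℕ} (m : ℕ) (T : Set (EuclideanSpace ℝ (Fin n))) : Prop :=
  ∃ S : Set (EuclideanSpace ℝ (Fin n)), IsLinearlyRegularFlat m S ∧
    ∃ ε : ℝ, 0 < ε ∧ ∃ x ∈ S ∩ T, {u | u ∈ S ∧ dist x u < ε} ⊆ T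

/-! ### Monadic expansions of `(T, β)` and their first-order logic -/

/-- One ternary symbol `β`, and one unary symbol for each `i : ι`. -/
inductive MonadicRel (ι : Type) : ℕ → Type
  | betw : MonadicRel ι 3
  | pred (i : ι) : MonadicRel ι 1

/-- The relational vocabulary `{β} ∪ {Pᵢ | i : ι}`. -/
def monadicLanguage (ι : Type) : FirstOrder.Language.{0, 0} where
  Functions := fun _ => Empty
  Relations := MonadicRel ι

/-- The expansion `(T, β, (Pᵢ))` of the betweenness structure `(T, β)`. -/
@[reducible] def expansion {n : ℕ} {ι : Type} (T : Set (EuclideanSpace ℝ (Fin n)))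
    (P : ι → Set T) : (monadicLanguage ι).Structure T where
  funMap := fun f _ => Empty.elim f
  RelMap := fun R v =>
    match R, v with
    | MonadicRel.betw, v => Betw (v 0 : EuclideanSpace ℝ (Fin n)) (v 1) (v 2)
    | MonadicRel.pred i, v => v 0 ∈ P i

/-- Truth of a first-order sentence in the expansion `(T, β, (Pᵢ))`. -/
def Holds {n : ℕ} {ι : Type} (T : Set (EuclideanSpace ℝ (Fin n))) (P : ι → Set T)
    (φ : (monadicLanguage ι).Sentence) : Prop :=
  @FirstOrder.Language.Sentence.Realize (monadicLanguage ι) T (expansion T P) φ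

/-- A monadic `Π¹₁`-sentence `∀ X₀ ⋯ ∀ X_{k-1} φ` of the vocabulary `{β}`, where `φ` is a
first-order sentence of the vocabulary `{β, X₀, …, X_{k-1}}`. -/
structure MonadicPiSentence where
  arity : ℕ
  kernel : (monadicLanguage (Fin arity)).Sentence

/-- The weak monadic `Π¹₁`-theory of `(T, β)`: the monadic `Π¹₁`-sentences that are true in
`(T, β)` when the set quantifiers range over the finite subsets of `T`. -/
def weakMonadicPiTheory {n : ℕ} (T : Set (EuclideanSpace ℝ (Fin n))) : Set MonadicPiSentence :=
  {Φ | ∀ X : Fin Φ.arity → Set T, (∀ i, (X i).Finite) → Holds T X Φ.kernel}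

/-- The first-order theory of the class of all expansions `(T, β, (Pᵢ)_{i ∈ ℕ})` of `(T, β)` by
finite unary predicates: the sentences that are true in all of these structures. -/
def finiteExpansionTheory {n : ℕ} (T : Set (EuclideanSpace ℝ (Fin n))) :
    Set (monadicLanguage ℕ).Sentence :=
  {φ | ∀ P : ℕ → Set T, (∀ i, (P i).Finite) → Holds T P φ}

/-! ### Gödel numbers -/

/-- The index of the variable that a term is (there are no other terms, and no named free
variables). -/
def termCode {ι : Type} {k : ℕ} : (monadicLanguage ι).Term (Empty ⊕ Fin k) → ℕ
  | .var (.inl e) => e.elim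
  | .var (.inr j) => j
  | .func f _ => Empty.elim f

/-- The Gödel number of an atomic formula; `ν` numbers the unary symbols, `v` lists the variables. -/
def relCode {ι : Type} (ν : ι → ℕ) : {l : ℕ} → MonadicRel ι l → (Fin l → ℕ) → ℕ
  | _, .betw, v => Nat.pair 2 (Nat.pair (v 0) (Nat.pair (v 1) (v 2)))
  | _, .pred i, v => Nat.pair 3 (Nat.pair (ν i) (v 0))

/-- The Gödel number of a first-order formula, relative to a numbering `ν` of the unary symbols. -/
def formulaCode {ι : Type} (ν : ι → ℕ) :
    {k : ℕ} → (monadicLanguage ι).BoundedFormula Empty k → ℕ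
  | _, .falsum => Nat.pair 0 0
  | _, .equal t₁ t₂ => Nat.pair 1 (Nat.pair (termCode t₁) (termCode t₂))
  | _, .rel R ts => relCode ν R (fun j => termCode (ts j))
  | _, .imp φ ψ => Nat.pair 4 (Nat.pair (formulaCode ν φ) (formulaCode ν ψ))
  | _, .all φ => Nat.pair 5 (formulaCode ν φ)

/-- The Gödel number of a first-order sentence of the vocabulary `{β} ∪ {Pᵢ | i ∈ ℕ}`. -/
def sentenceCode (φ : (monadicLanguage ℕ).Sentence) : ℕ :=
  formulaCode id φ

/-- The Gödel number of a monadic `Π¹₁`-sentence. -/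
def piSentenceCode (Φ : MonadicPiSentence) : ℕ :=
  Nat.pair Φ.arity (formulaCode Fin.val Φ.kernel)

theorem termCode_injective {ι : Type} {k : ℕ} :
    Function.Injective (termCode (ι := ι) (k := k)) := by
  intro s t h
  match s, t, h with
  | .var (.inl e), _, _ => exact e.elim
  | _, .var (.inl e), _ => exact e.elim
  | .func f _, _, _ => exact Empty.elim f
  | _, .func f _, _ => exact Empty.elim f
  | .var (.inr i), .var (.inr j), h =>
    have : i = j := Fin.ext h
    rw [this]

theorem formulaCode_injective {ι : Type} {ν : ι → ℕ} (hν : Function.Injective ν) {k : ℕ}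
    (φ ψ : (monadicLanguage ι).BoundedFormula Empty k)
    (h : formulaCode ν φ = formulaCode ν ψ) : φ = ψ := by
  induction φ with
  | falsum =>
    match ψ, h with
    | .falsum, _ => rfl
    | .equal _ _, h => simp [formulaCode] at h
    | .rel .betw _, h => simp [formulaCode, relCode] at h
    | .rel (.pred _) _, h => simp [formulaCode, relCode] at h
    | .imp _ _, h => simp [formulaCode] at h
    | .all _, h => simp [formulaCode] at h
  | equal t₁ t₂ =>
    match ψ, h with
    | .falsum, h => simp [formulaCode] at h
    | .equal s₁ s₂, h =>
      simp only [formulaCode, Nat.pair_eq_pair, true_and] at h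
      rw [termCode_injective h.1, termCode_injective h.2]
    | .rel .betw _, h => simp [formulaCode, relCode] at h
    | .rel (.pred _) _, h => simp [formulaCode, relCode] at h
    | .imp _ _, h => simp [formulaCode] at h
    | .all _, h => simp [formulaCode] at h
  | rel R ts =>
    match R, ts, ψ, h with
    | .betw, _, .falsum, h => simp [formulaCode, relCode] at h
    | .betw, _, .equal _ _, h => simp [formulaCode, relCode] at h
    | .betw, ts, .rel .betw ts', h =>
      simp only [formulaCode, relCode, Nat.pair_eq_pair, true_and] at h
      have : ts = ts' := by
        funext j
        fin_cases j
        · exact termCode_injective h.1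
        · exact termCode_injective h.2.1
        · exact termCode_injective h.2.2
      rw [this]
    | .betw, _, .rel (.pred _) _, h => simp [formulaCode, relCode] at h
    | .betw, _, .imp _ _, h => simp [formulaCode, relCode] at h
    | .betw, _, .all _, h => simp [formulaCode, relCode] at h
    | .pred _, _, .falsum, h => simp [formulaCode, relCode] at h
    | .pred _, _, .equal _ _, h => simp [formulaCode, relCode] at h
    | .pred _, _, .rel .betw _, h => simp [formulaCode, relCode] at h
    | .pred i, ts, .rel (.pred j) ts', h =>
      simp only [formulaCode, relCode, Nat.pair_eq_pair, true_and] at h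
      have h₁ : i = j := hν h.1
      have h₂ : ts = ts' := by
        funext j
        fin_cases j
        exact termCode_injective h.2
      rw [h₁, h₂]
    | .pred _, _, .imp _ _, h => simp [formulaCode, relCode] at h
    | .pred _, _, .all _, h => simp [formulaCode, relCode] at h
  | imp φ₁ φ₂ ih₁ ih₂ =>
    match ψ, h with
    | .falsum, h => simp [formulaCode] at h
    | .equal _ _, h => simp [formulaCode] at h
    | .rel .betw _, h => simp [formulaCode, relCode] at h
    | .rel (.pred _) _, h => simp [formulaCode, relCode] at h
    | .imp ψ₁ ψ₂, h =>
      simp only [formulaCode, Nat.pair_eq_pair, true_and] at h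
      rw [ih₁ _ h.1, ih₂ _ h.2]
    | .all _, h => simp [formulaCode] at h
  | all φ ih =>
    match ψ, h with
    | .falsum, h => simp [formulaCode] at h
    | .equal _ _, h => simp [formulaCode] at h
    | .rel .betw _, h => simp [formulaCode, relCode] at h
    | .rel (.pred _) _, h => simp [formulaCode, relCode] at h
    | .imp _ _, h => simp [formulaCode] at h
    | .all ψ, h =>
      simp only [formulaCode, Nat.pair_eq_pair, true_and] at h
      rw [ih _ h]

theorem sentenceCode_injective : Function.Injective sentenceCode :=
  fun φ ψ h => formulaCode_injective Function.injective_id φ ψ h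

theorem piSentenceCode_injective : Function.Injective piSentenceCode := by
  rintro ⟨a, φ⟩ ⟨b, ψ⟩ h
  obtain ⟨hab, hc⟩ := Nat.pair_eq_pair.1 h
  dsimp only at hab
  subst hab
  have := formulaCode_injective Fin.val_injective φ ψ hc
  rw [this]

/-! ### Hardness and undecidability -/

/-- A set `A` of objects with Gödel numbers is `Π⁰₁`-hard: every `Π⁰₁` set of natural numbers (a
set with recursively enumerable complement) is reducible to `A` by a computable function. -/
def PiZeroOneHard {S : Type} (code : S → ℕ) (A : Set S) : Prop :=
  ∀ B : ℕ → Prop, REPred (fun x => ¬ B x) →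
    ∃ f : ℕ → S, Computable (fun x => code (f x)) ∧ ∀ x, B x ↔ f x ∈ A

/-- A set `A` of objects with Gödel numbers is decidable: some computable function decides
membership in `A` from the Gödel number of an object. -/
def DecidableByCode {S : Type} (code : S → ℕ) (A : Set S) : Prop :=
  ∃ d : ℕ → Bool, Computable d ∧ ∀ s, s ∈ A ↔ d (code s) = true

end BetweennessTheories

namespace BetweennessTheories

/-! ### Grids in sets that extend linearly in two dimensions -/

section Geometry

variable {n : ℕ} {s t u : EuclideanSpace ℝ (Fin n)}

/-! The halting problem is encoded in finite configurations of points. Let `B` have recursively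
enumerable complement, the domain of a code `c`. The sentence assigned to a number says: whenever
the predicates, read through two points `a`, `b` as an arithmetic with tables of values for `c` and
its subcodes, pass a first-order check, that number is not marked as an input. It fails in some
finite expansion exactly when `c` halts on the number.

The check is sound on every finite domain, whatever the geometry. Let the rank of an element be the
number of its predecessors; every table entry that passes is then true of ranks
(`Arith.rank_unpair`, `Arith.Evaluates.mem_eval`). As marked inputs must have values, `c` halts on
them.

Conversely, a halting computation needs finite point sets that code binary relations. Lines from `a`
and `b` through points `d i` of a third line meet in points `g i j`, and a set of such points is a
relation on indices (`ExtendsLinearly.exists_grid`). Density supplies the `d i`, linear closedness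
the `g i j`, and working near the given centre keeps all of them in `T`. True arithmetic on an
initial segment, with the graphs of `Code.evaln (k + 1)` as tables, passes the check
(`Arith.exists_evaluates`).

For fixed `c` the check is one fixed formula. Only a chain of successors from zero varies with the
number, so Gödel numbers are primitive recursive. -/

theorem betw_iff_wbtw : Betw s t u ↔ Wbtw ℝ s t u := by
  rw [Betw, eq_comm]
  exact dist_add_dist_eq_iff

theorem collinearTriple_iff : CollinearTriple s t u ↔ Collinear ℝ {s, t, u} := by
  simp only [CollinearTriple, betw_iff_wbtw]
  constructor
  · rintro (h | h | h)
    · exact h.collinear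
    · rw [Set.pair_comm]; exact h.collinear
    · rw [Set.insert_comm]; exact h.collinear
  · intro h
    rcases h.wbtw_or_wbtw_or_wbtw with h | h | h
    · exact .inl h
    · exact .inr (.inl h.symm)
    · exact .inr (.inr h.symm)

theorem collinear_triple_iff_mem_line (hst : s ≠ t) :
    Collinear ℝ {s, t, u} ↔ u ∈ line[ℝ, s, t] := by
  constructor
  · intro h
    exact h.mem_affineSpan_of_mem_of_ne (by simp) (by simp) (by simp) hst
  · intro h
    exact collinear_triple_of_mem_affineSpan_pair (left_mem_affineSpan_pair ℝ s t)
      (right_mem_affineSpan_pair ℝ s t) h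

/-- The points of `U` on the line through `s` and `t`. -/
def secant (U : Set (EuclideanSpace ℝ (Fin n))) (s t : EuclideanSpace ℝ (Fin n)) :
    Set (EuclideanSpace ℝ (Fin n)) :=
  {u | u ∈ U ∧ u ∈ line[ℝ, s, t]}

theorem isLineIn_secant {U : Set (EuclideanSpace ℝ (Fin n))} (hs : s ∈ U) (ht : t ∈ U)
    (hst : s ≠ t) : IsLineIn U (secant U s t) where
  subset := fun _ h => h.1
  exists_ne := ⟨s, ⟨hs, left_mem_affineSpan_pair ℝ s t⟩, t,
    ⟨ht, right_mem_affineSpan_pair ℝ s t⟩, hst⟩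
  collinear := fun _ hx _ hy _ hz =>
    collinearTriple_iff.2 (collinear_triple_of_mem_affineSpan_pair hx.2 hy.2 hz.2)
  mem_of_betw := by
    intro x hx y hy hxy u hu h
    refine ⟨hu, ?_⟩
    have hc : Collinear ℝ {x, y, u} := collinearTriple_iff.1 <| by
      rcases h with h | h
      · exact .inr (.inl h)
      · exact .inl h
    exact affineSpan_pair_le_of_mem_of_mem hx.2 hy.2 ((collinear_triple_iff_mem_line hxy).1 hc)

/-- Linear completeness in parametric form: approximate the midpoint parameter to within half the
gap, scaled by `‖t - s‖`. -/
theorem IsLinearlyRegularFlat.exists_mem_between {m : ℕ} {S : Set (EuclideanSpace ℝ (Fin n))}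
    (hS : IsLinearlyRegularFlat m S) (hs : s ∈ S) (ht : t ∈ S) (hst : s ≠ t) {α β : ℝ}
    (hαβ : α < β) : ∃ τ, α < τ ∧ τ < β ∧ s + τ • (t - s) ∈ S := by
  have hpos : 0 < ‖t - s‖ := norm_pos_iff.2 (sub_ne_zero.2 hst.symm)
  have key : ∀ τ : ℝ, s + τ • (t - s) ∈ line[ℝ, s, t] := fun τ => by
    have := AffineMap.lineMap_mem_affineSpan_pair τ s t
    rwa [AffineMap.lineMap_apply, vsub_eq_sub, vadd_eq_add, add_comm] at this
  obtain ⟨w, hw, hd⟩ := hS.linearlyComplete _ _ (isLineIn_secant hs ht hst)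
    (isLineIn_secant (Set.mem_univ s) (Set.mem_univ t) hst) (fun _ h => ⟨trivial, h.2⟩)
    (s + ((α + β) / 2) • (t - s)) ⟨trivial, key _⟩ ((β - α) / 2 * ‖t - s‖)
    (mul_pos (by linarith) hpos)
  obtain ⟨τ, rfl⟩ := mem_affineSpan_pair_iff_exists_lineMap_eq.1 hw.2
  rw [AffineMap.lineMap_apply, vsub_eq_sub, vadd_eq_add, add_comm] at hd hw
  rw [dist_eq_norm, add_sub_add_left_eq_sub, ← sub_smul, norm_smul, Real.norm_eq_abs] at hd
  have := abs_lt.1 (lt_of_mul_lt_mul_right hd hpos.le)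
  exact ⟨τ, by linarith [this.1], by linarith [this.2], hw.1⟩

/-- Linear closedness yields some common point `w` of the two secants. By `hne` the lines differ, so
they cannot share two points and `w = z`. -/
theorem IsLinearlyRegularFlat.mem_of_collinear {m : ℕ} {S : Set (EuclideanSpace ℝ (Fin n))}
    (hS : IsLinearlyRegularFlat m S) {s' t' z : EuclideanSpace ℝ (Fin n)}
    (hs : s ∈ S) (ht : t ∈ S) (hs' : s' ∈ S) (ht' : t' ∈ S) (hst : s ≠ t) (hst' : s' ≠ t')
    (hne : ¬ Collinear ℝ {s', t', s}) (hz : Collinear ℝ {s, t, z})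
    (hz' : Collinear ℝ {s', t', z}) : z ∈ S := by
  rw [collinear_triple_iff_mem_line hst] at hz
  rw [collinear_triple_iff_mem_line hst'] at hne hz'
  obtain ⟨w, hwS, hw⟩ := hS.linearlyClosed _ _ (isLineIn_secant hs ht hst)
    (isLineIn_secant hs' ht' hst')
    ⟨fun h => hne (h.subset (show s ∈ secant S s t from
      ⟨hs, left_mem_affineSpan_pair ℝ s t⟩)).2, _, _,
      isLineIn_secant (Set.mem_univ s) (Set.mem_univ t) hst,
      isLineIn_secant (Set.mem_univ s') (Set.mem_univ t') hst',
      fun _ h => ⟨trivial, h.2⟩, fun _ h => ⟨trivial, h.2⟩, z, ⟨trivial, hz⟩, trivial, hz'⟩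
  by_cases hwz : w = z
  · exact hwz ▸ hwS
  · refine absurd ?_ hne
    have hc : Collinear ℝ {w, z, s} :=
      collinear_triple_of_mem_affineSpan_pair hw.1.2 hz (left_mem_affineSpan_pair ℝ s t)
    exact affineSpan_pair_le_of_mem_of_mem hw.2.2 hz' ((collinear_triple_iff_mem_line hwz).1 hc)

/-- In affine coordinates collinearity is the vanishing of a determinant, which turns incidences in
the grid into polynomial identities. -/
theorem collinear_coordinates_iff {x e f : EuclideanSpace ℝ (Fin n)}
    (hef : LinearIndependent ℝ ![e, f]) {α₁ β₁ α₂ β₂ α₃ β₃ : ℝ} :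
    Collinear ℝ {x + α₁ • e + β₁ • f, x + α₂ • e + β₂ • f, x + α₃ • e + β₃ • f} ↔
      (α₂ - α₁) * (β₃ - β₁) = (α₃ - α₁) * (β₂ - β₁) := by
  have ind := LinearIndependent.pair_iff.1 hef
  rw [collinear_iff_of_mem (p₀ := x + α₁ • e + β₁ • f) (by simp)]
  constructor
  · rintro ⟨v, hv⟩
    obtain ⟨r, hr⟩ := hv (x + α₂ • e + β₂ • f) (by simp)
    obtain ⟨r', hr'⟩ := hv (x + α₃ • e + β₃ • f) (by simp)
    rw [vadd_eq_add] at hr hr'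
    have h : r • v = (α₂ - α₁) • e + (β₂ - β₁) • f := by
      rw [← sub_eq_zero]
      have := sub_eq_zero.2 hr
      rw [← neg_eq_zero, ← this]
      module
    have h' : r' • v = (α₃ - α₁) • e + (β₃ - β₁) • f := by
      rw [← sub_eq_zero]
      have := sub_eq_zero.2 hr'
      rw [← neg_eq_zero, ← this]
      module
    by_cases hr0 : r = 0
    · have h0 := ind (α₂ - α₁) (β₂ - β₁) (by rw [← h, hr0, zero_smul])
      rw [h0.1, h0.2]; ring
    · have hc := ind (r' * (α₂ - α₁) - r * (α₃ - α₁)) (r' * (β₂ - β₁) - r * (β₃ - β₁)) (by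
        have : r' • (r • v) = r • (r' • v) := smul_comm _ _ _
        rw [h, h'] at this
        rw [← sub_eq_zero] at this
        rw [← this]
        module)
      apply mul_left_cancel₀ hr0
      linear_combination (β₂ - β₁) * hc.1 - (α₂ - α₁) * hc.2
  · intro h
    by_cases h0 : α₂ - α₁ = 0 ∧ β₂ - β₁ = 0
    · refine ⟨(α₃ - α₁) • e + (β₃ - β₁) • f, ?_⟩
      have h1 : α₂ = α₁ := by linarith [h0.1]
      have h2 : β₂ = β₁ := by linarith [h0.2]
      subst h1 h2
      rintro p (rfl | rfl | rfl)
      · exact ⟨0, by simp⟩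
      · exact ⟨0, by simp⟩
      · exact ⟨1, by rw [vadd_eq_add]; module⟩
    · refine ⟨(α₂ - α₁) • e + (β₂ - β₁) • f, ?_⟩
      rintro p (rfl | rfl | rfl)
      · exact ⟨0, by simp⟩
      · exact ⟨1, by rw [vadd_eq_add]; module⟩
      · by_cases ha : α₂ - α₁ = 0
        · have hb : β₂ - β₁ ≠ 0 := fun hb => h0 ⟨ha, hb⟩
          have h3 : α₃ - α₁ = 0 := by
            rw [ha, zero_mul, eq_comm, mul_eq_zero] at h
            exact h.resolve_right hb
          refine ⟨(β₃ - β₁) / (β₂ - β₁), ?_⟩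
          rw [vadd_eq_add, ha, smul_add, smul_smul, smul_smul, div_mul_cancel₀ _ hb,
            show α₃ = α₁ by linarith]
          module
        · refine ⟨(α₃ - α₁) / (α₂ - α₁), ?_⟩
          have h3 : (α₃ - α₁) / (α₂ - α₁) * (β₂ - β₁) = β₃ - β₁ := by
            field_simp; linarith
          rw [vadd_eq_add, smul_add, smul_smul, smul_smul, div_mul_cancel₀ _ ha, h3]
          module

theorem IsLinearlyRegularFlat.exists_linearIndependent {S : Set (EuclideanSpace ℝ (Fin n))}
    (hS : IsLinearlyRegularFlat 2 S) (x : EuclideanSpace ℝ (Fin n)) :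
    ∃ p ∈ S, ∃ q ∈ S, LinearIndependent ℝ ![p - x, q - x] := by
  have line : ∀ w : EuclideanSpace ℝ (Fin n), w ≠ 0 → ∃ y ∈ S, ∀ r : ℝ, y ≠ x + r • w := by
    intro w hw
    by_contra! h
    refine hS.not_subset_flat 1 rfl ⟨_, ⟨fun _ => w, x, ?_, rfl⟩, fun y hy => ?_⟩
    · exact linearIndependent_unique_iff.2 hw
    · obtain ⟨r, hr⟩ := h y hy
      exact ⟨fun _ => r, by simpa using hr⟩
  obtain ⟨_, ⟨v, _, hv, -⟩, -⟩ := hS.subset_flat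
  -- Any nonzero direction would do here; only `p ≠ x` is kept.
  obtain ⟨p, hp, hpx⟩ := line (v 0) (hv.ne_zero 0)
  have hpx : p - x ≠ 0 := sub_ne_zero.2 (by simpa using hpx 0)
  obtain ⟨q, hq, hqx⟩ := line (p - x) hpx
  refine ⟨p, hp, q, hq, (LinearIndependent.pair_iff' hpx).2 fun r hr => hqx r ?_⟩
  rw [hr]; abel

theorem IsLinearlyRegularFlat.exists_small_triangle {S : Set (EuclideanSpace ℝ (Fin n))}
    (hS : IsLinearlyRegularFlat 2 S) {x : EuclideanSpace ℝ (Fin n)} (hx : x ∈ S) {ε : ℝ}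
    (hε : 0 < ε) : ∃ e f, LinearIndependent ℝ ![e, f] ∧ x + e ∈ S ∧ x + f ∈ S ∧
      ‖e‖ < ε / 2 ∧ ‖f‖ < ε / 2 := by
  have small : ∀ p ∈ S, p ≠ x → ∃ τ : ℝ, τ ≠ 0 ∧ x + τ • (p - x) ∈ S ∧
      ‖τ • (p - x)‖ < ε / 2 := by
    intro p hp hpx
    have hpos : 0 < ‖p - x‖ := norm_pos_iff.2 (sub_ne_zero.2 hpx)
    obtain ⟨τ, h0, h1, hτ⟩ := hS.exists_mem_between hx hp hpx.symm
      (show 0 < ε / 2 / ‖p - x‖ by positivity)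
    refine ⟨τ, h0.ne', hτ, ?_⟩
    rw [norm_smul, Real.norm_of_nonneg h0.le]
    exact (lt_div_iff₀ hpos).1 h1
  obtain ⟨p, hp, q, hq, ind⟩ := hS.exists_linearIndependent x
  obtain ⟨τ, hτ, hτS, hτε⟩ := small p hp (sub_ne_zero.1 (ind.ne_zero 0))
  obtain ⟨σ, hσ, hσS, hσε⟩ := small q hq (sub_ne_zero.1 (ind.ne_zero 1))
  refine ⟨_, _, ?_, hτS, hσS, hτε, hσε⟩
  rw [LinearIndependent.pair_iff] at ind ⊢
  intro r r' h
  have := ind (r * τ) (r' * σ) (by rw [mul_smul, mul_smul]; exact h)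
  simpa [hτ, hσ] using this

/-- Take coordinates with origin `x`, `a = (1, 0)` and `b = (0, 1)`. The `d i` lie on a segment from
the origin to a point of the open segment `ab`, and `g i j` is where the lines `a (d i)` and `b (d
j)` meet. Everything stays in the unit square, hence within `ε` of `x`. -/
theorem ExtendsLinearly.exists_grid {T : Set (EuclideanSpace ℝ (Fin n))}
    (hT : ExtendsLinearly 2 T) (N : ℕ) :
    ∃ (a b : T) (d : Fin N → T) (g : Fin N → Fin N → T),
      (∀ i j k, CollinearTriple (a : EuclideanSpace ℝ (Fin n)) (d k) (g i j) ↔ k = i) ∧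
      (∀ i j k, CollinearTriple (b : EuclideanSpace ℝ (Fin n)) (d k) (g i j) ↔ k = j) := by
  obtain ⟨S, hS, ε, hε, x, ⟨hxS, hxT⟩, hST⟩ := hT
  obtain ⟨e, f, ind, heS, hfS, he, hf⟩ := hS.exists_small_triangle hxS hε
  set P : ℝ → ℝ → EuclideanSpace ℝ (Fin n) := fun α β => x + α • e + β • f with hP
  have coll : ∀ {α₁ β₁ α₂ β₂ α₃ β₃ : ℝ}, Collinear ℝ {P α₁ β₁, P α₂ β₂, P α₃ β₃} ↔
      (α₂ - α₁) * (β₃ - β₁) = (α₃ - α₁) * (β₂ - β₁) := collinear_coordinates_iff ind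
  have inj : ∀ {α β α' β' : ℝ}, P α β = P α' β' → α = α' ∧ β = β' := by
    intro α β α' β' h
    have := LinearIndependent.pair_iff.1 ind (α - α') (β - β') (by
      rw [← sub_eq_zero] at h; rw [← h]; simp only [hP]; module)
    exact ⟨by linarith [this.1], by linarith [this.2]⟩
  have memT : ∀ {α β : ℝ}, 0 ≤ α → α ≤ 1 → 0 ≤ β → β ≤ 1 → P α β ∈ S → P α β ∈ T := by
    intro α β hα hα' hβ hβ' h
    refine hST ⟨h, ?_⟩
    rw [dist_eq_norm, show x - P α β = -(α • e + β • f) by simp only [hP]; abel, norm_neg]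
    calc ‖α • e + β • f‖ ≤ ‖α • e‖ + ‖β • f‖ := norm_add_le _ _
      _ ≤ 1 * ‖e‖ + 1 * ‖f‖ := by
        rw [norm_smul, norm_smul, Real.norm_of_nonneg hα, Real.norm_of_nonneg hβ]
        gcongr
      _ < ε := by linarith
  have haS : P 1 0 ∈ S := by simpa [hP] using heS
  have hbS : P 0 1 ∈ S := by simpa [hP] using hfS
  have hoS : P 0 0 ∈ S := by simpa [hP] using hxS
  -- The third line must avoid `a` and `b`: otherwise all the lines from that centre to the `d i`
  -- would coincide.
  obtain ⟨μ, hμ0, hμ1, hμS⟩ := hS.exists_mem_between haS hbS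
    (fun h => by simpa using (inj h).1) one_pos
  replace hμS : P (1 - μ) μ ∈ S := by
    convert hμS using 1; simp only [hP]; module
  -- Disjoint subintervals of the unit interval make the parameters strictly increasing and keep
  -- them strictly between 0 and 1.
  have hτ : ∀ i : Fin N, ∃ τ : ℝ, (i : ℝ) / N < τ ∧ τ < ((i : ℝ) + 1) / N ∧
      P (τ * (1 - μ)) (τ * μ) ∈ S := by
    intro i
    have hN : (0 : ℝ) < N := by exact_mod_cast i.pos
    obtain ⟨τ, h0, h1, h2⟩ := hS.exists_mem_between hoS hμS
      (fun h => hμ0.ne (inj h).2) (show (i : ℝ) / N < ((i : ℝ) + 1) / N by gcongr; linarith)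
    refine ⟨τ, h0, h1, ?_⟩
    convert h2 using 1; simp only [hP]; module
  choose τ hτl hτu hτS using hτ
  have τpos : ∀ i, 0 < τ i := fun i => lt_of_le_of_lt (by positivity) (hτl i)
  have τlt : ∀ i, τ i < 1 := fun i => by
    have hN : (0 : ℝ) < N := by exact_mod_cast i.pos
    refine (hτu i).trans_le ((div_le_one hN).2 ?_)
    exact_mod_cast i.is_lt
  have τmono : ∀ i j : Fin N, i < j → τ i < τ j := fun i j hij => by
    have hN : (0 : ℝ) < N := by exact_mod_cast i.pos
    refine (hτu i).trans (lt_of_le_of_lt ?_ (hτl j))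
    gcongr
    exact_mod_cast hij
  have τinj : Function.Injective τ := (show StrictMono τ from τmono).injective
  -- Axis intercepts: the line `b (d i)` meets the first axis at `l i`, the line `a (d i)` meets the
  -- second at `m i`. The lines `a (d i)` and `b (d j)` have equations `Y = m i * (1 - X)` and `X =
  -- l j * (1 - Y)`; their solution is `X i j`, `Y i j`.
  set l : Fin N → ℝ := fun i => τ i * (1 - μ) / (1 - τ i * μ) with hl
  set m : Fin N → ℝ := fun i => τ i * μ / (1 - τ i * (1 - μ)) with hm
  have den1 : ∀ i, 0 < 1 - τ i * μ := fun i => by nlinarith [τpos i, τlt i]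
  have den2 : ∀ i, 0 < 1 - τ i * (1 - μ) := fun i => by nlinarith [τpos i, τlt i]
  have l0 : ∀ i, 0 < l i := fun i => div_pos (mul_pos (τpos i) (by linarith)) (den1 i)
  have m0 : ∀ i, 0 < m i := fun i => div_pos (mul_pos (τpos i) hμ0) (den2 i)
  have l1 : ∀ i, l i < 1 := fun i => (div_lt_one (den1 i)).2 (by nlinarith [τlt i])
  have m1 : ∀ i, m i < 1 := fun i => (div_lt_one (den2 i)).2 (by nlinarith [τlt i])
  have lm : ∀ i j, 0 < 1 - l j * m i := fun i j => by nlinarith [l0 j, m0 i, l1 j, m1 i]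
  set X : Fin N → Fin N → ℝ := fun i j => l j * (1 - m i) / (1 - l j * m i) with hX
  set Y : Fin N → Fin N → ℝ := fun i j => m i * (1 - l j) / (1 - l j * m i) with hY
  have X0 : ∀ i j, 0 < X i j := fun i j => div_pos (mul_pos (l0 j) (by linarith [m1 i])) (lm i j)
  have Y0 : ∀ i j, 0 < Y i j := fun i j => div_pos (mul_pos (m0 i) (by linarith [l1 j])) (lm i j)
  have X1 : ∀ i j, X i j < 1 := fun i j => (div_lt_one (lm i j)).2 (by nlinarith [l1 j])
  have Y1 : ∀ i j, Y i j < 1 := fun i j => (div_lt_one (lm i j)).2 (by nlinarith [m1 i])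
  have eX : ∀ i j, X i j * (1 - l j * m i) = l j * (1 - m i) :=
    fun i j => div_mul_cancel₀ _ (lm i j).ne'
  have eY : ∀ i j, Y i j * (1 - l j * m i) = m i * (1 - l j) :=
    fun i j => div_mul_cancel₀ _ (lm i j).ne'
  have eqm : ∀ i j, Y i j = m i * (1 - X i j) := fun i j => by
    apply mul_right_cancel₀ (lm i j).ne'
    linear_combination eY i j + m i * eX i j
  have eql : ∀ i j, X i j = l j * (1 - Y i j) := fun i j => by
    apply mul_right_cancel₀ (lm i j).ne'
    linear_combination eX i j + l j * eY i j
  have slm : ∀ i, m i * (1 - τ i * (1 - μ)) = τ i * μ := fun i => div_mul_cancel₀ _ (den2 i).ne'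
  have sll : ∀ i, l i * (1 - τ i * μ) = τ i * (1 - μ) := fun i => div_mul_cancel₀ _ (den1 i).ne'
  have minj : Function.Injective m := fun i j h => τinj <| by
    have h1 := slm i
    rw [h] at h1
    have : (τ i - τ j) * (μ + m j * (1 - μ)) = 0 := by linear_combination slm j - h1
    rcases mul_eq_zero.1 this with h | h
    · linarith
    · nlinarith [m0 j]
  have linj : Function.Injective l := fun i j h => τinj <| by
    have h1 := sll i
    rw [h] at h1
    have : (τ i - τ j) * ((1 - μ) + l j * μ) = 0 := by linear_combination sll j - h1
    rcases mul_eq_zero.1 this with h | h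
    · linarith
    · nlinarith [l0 j]
  have Ha : ∀ i j k, Collinear ℝ {P 1 0, P (τ k * (1 - μ)) (τ k * μ), P (X i j) (Y i j)} ↔
      k = i := by
    intro i j k
    rw [coll]
    constructor
    · intro h
      apply minj
      rw [eqm, ← slm] at h
      have hne : (1 - X i j) * (1 - τ k * (1 - μ)) ≠ 0 :=
        (mul_pos (by linarith [X1 i j]) (den2 k)).ne'
      apply mul_right_cancel₀ hne
      linear_combination h
    · rintro rfl
      rw [eqm, ← slm]; ring
  have Hb : ∀ i j k, Collinear ℝ {P 0 1, P (τ k * (1 - μ)) (τ k * μ), P (X i j) (Y i j)} ↔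
      k = j := by
    intro i j k
    rw [coll]
    constructor
    · intro h
      apply linj
      rw [eql, ← sll] at h
      have hne : (1 - Y i j) * (1 - τ k * μ) ≠ 0 :=
        (mul_pos (by linarith [Y1 i j]) (den1 k)).ne'
      apply mul_right_cancel₀ hne
      linear_combination -h
    · rintro rfl
      rw [eql, ← sll]; ring
  have hgS : ∀ i j, P (X i j) (Y i j) ∈ S := by
    intro i j
    refine hS.mem_of_collinear haS (hτS i) hbS (hτS j) ?_ ?_ ?_ ((Ha i j i).2 rfl)
      ((Hb i j j).2 rfl)
    · intro h
      exact (mul_pos (τpos i) hμ0).ne (inj h).2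
    · intro h
      exact (mul_pos (τpos j) (by linarith)).ne (inj h).1
    · rw [coll]
      intro h
      nlinarith [τlt j]
  refine ⟨⟨P 1 0, memT zero_le_one le_rfl le_rfl zero_le_one haS⟩,
    ⟨P 0 1, memT le_rfl zero_le_one zero_le_one le_rfl hbS⟩,
    fun i => ⟨P (τ i * (1 - μ)) (τ i * μ), memT ?_ ?_ ?_ ?_ (hτS i)⟩,
    fun i j => ⟨P (X i j) (Y i j), memT (X0 i j).le (X1 i j).le (Y0 i j).le (Y1 i j).le (hgS i j)⟩,
    fun i j k => collinearTriple_iff.trans (Ha i j k),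
    fun i j k => collinearTriple_iff.trans (Hb i j k)⟩
  · exact (mul_pos (τpos i) (by linarith)).le
  · linarith [den2 i]
  · exact (mul_pos (τpos i) hμ0).le
  · linarith [den1 i]

end Geometry

/-! ### Finite structures that verify evaluations of a partial recursive code -/

section Arithmetic

open Nat.Partrec Encodable

/-- Relations on `M` to be read as the arithmetic of an initial segment `dom` of `ℕ`: the zero, an
input, the order, the successor, the two components of `Nat.unpair`, and for each code the graph of
(a part of) the function it computes. -/
structure Arith (M : Type*) where
  dom : M → Prop
  zero : M → Prop
  input : M → Prop
  lt : M → M → Prop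
  succ : M → M → Prop
  left : M → M → Prop
  right : M → M → Prop
  val : Code → M → M → Prop

namespace Arith

variable {M : Type*} (A : Arith M)

/-- Neither linearity nor existence of successors is demanded, only what makes ranks behave. -/
def IsOrdered : Prop :=
  (∀ x, A.dom x → ¬ A.lt x x) ∧
  (∀ x, A.dom x → ∀ y, A.dom y → ∀ z, A.dom z → A.lt x y → A.lt y z → A.lt x z) ∧
  (∀ x, A.dom x → ∀ y, A.dom y → A.succ x y →
    A.lt x y ∧ ∀ z, A.dom z → A.lt z y → A.lt z x ∨ z = x) ∧
  (∀ x, A.dom x → A.zero x → ∀ y, A.dom y → ¬ A.lt y x)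

/-- The cases mirror `unpair_pair_add_one`: an entry at `z` is justified by entries at its
predecessor. -/
def UnpairsLeft : Prop :=
  ∀ z, A.dom z → ∀ c, A.dom c → A.left z c → (A.zero z ∧ A.zero c) ∨
    ∃ z', A.dom z' ∧ ∃ a, A.dom a ∧ ∃ b, A.dom b ∧
      A.succ z' z ∧ A.left z' a ∧ A.right z' b ∧
      ((A.lt a b ∧ A.succ a c) ∨ (A.lt b a ∧ c = a) ∨ (a = b ∧ A.zero c))

def UnpairsRight : Prop :=
  ∀ z, A.dom z → ∀ c, A.dom c → A.right z c → (A.zero z ∧ A.zero c) ∨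
    ∃ z', A.dom z' ∧ ∃ a, A.dom a ∧ ∃ b, A.dom b ∧
      A.succ z' z ∧ A.left z' a ∧ A.right z' b ∧
      ((A.lt a b ∧ ((A.succ a b ∧ A.zero c) ∨
          ∃ a', A.dom a' ∧ A.succ a a' ∧ A.lt a' b ∧ c = b)) ∨
        (A.lt b a ∧ A.succ b c) ∨ (a = b ∧ A.succ a c))

/-- Every fact about the values of a subcode of `c` is justified by other such facts. -/
def Evaluates : Code → Prop
  | .zero => ∀ x, A.dom x → ∀ y, A.dom y → A.val .zero x y → A.zero y
  | .succ => ∀ x, A.dom x → ∀ y, A.dom y → A.val .succ x y → A.succ x y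
  | .left => ∀ x, A.dom x → ∀ y, A.dom y → A.val .left x y → A.left x y
  | .right => ∀ x, A.dom x → ∀ y, A.dom y → A.val .right x y → A.right x y
  | .pair f g => Evaluates f ∧ Evaluates g ∧
    ∀ x, A.dom x → ∀ y, A.dom y → A.val (.pair f g) x y →
      ∃ u, A.dom u ∧ ∃ w, A.dom w ∧ A.val f x u ∧ A.val g x w ∧ A.left y u ∧ A.right y w
  | .comp f g => Evaluates f ∧ Evaluates g ∧
    ∀ x, A.dom x → ∀ y, A.dom y → A.val (.comp f g) x y →
      ∃ u, A.dom u ∧ A.val g x u ∧ A.val f u y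
  | .prec f g => Evaluates f ∧ Evaluates g ∧
    ∀ x, A.dom x → ∀ y, A.dom y → A.val (.prec f g) x y →
      ∃ a, A.dom a ∧ ∃ m, A.dom m ∧ A.left x a ∧ A.right x m ∧
        ((A.zero m ∧ A.val f a y) ∨
          ∃ m', A.dom m' ∧ ∃ x', A.dom x' ∧ ∃ i, A.dom i ∧ ∃ w, A.dom w ∧ ∃ q, A.dom q ∧
            A.succ m' m ∧ A.left x' a ∧ A.right x' m' ∧ A.val (.prec f g) x' i ∧
            A.left w a ∧ A.right w q ∧ A.left q m' ∧ A.right q i ∧ A.val g w y)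
  | .rfind' f => Evaluates f ∧
    ∀ x, A.dom x → ∀ y, A.dom y → A.val (.rfind' f) x y →
      ∃ r, A.dom r ∧ ∃ a, A.dom a ∧ ∃ m, A.dom m ∧ A.val f x r ∧ A.left x a ∧ A.right x m ∧
        ((A.zero r ∧ y = m) ∨
          ∃ r', A.dom r' ∧ ∃ m', A.dom m' ∧ ∃ x', A.dom x' ∧
            A.succ r' r ∧ A.succ m m' ∧ A.left x' a ∧ A.right x' m' ∧ A.val (.rfind' f) x' y)

/-- The other clauses only ask that entries already present be justified; here an input forces an
entry. -/
def HasValue (c : Code) : Prop :=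
  ∀ x, A.dom x → A.input x → ∃ y, A.dom y ∧ A.val c x y

def Verifies (c : Code) : Prop :=
  A.IsOrdered ∧ A.UnpairsLeft ∧ A.UnpairsRight ∧ A.Evaluates c ∧ A.HasValue c

/-- The number that an element of `A.dom` stands for. -/
noncomputable def rank (x : M) : ℕ :=
  {y | A.dom y ∧ A.lt y x}.ncard

variable {A}

/-! ### Soundness: verified facts are true of ranks -/

section Rank

variable (hA : A.IsOrdered) (hfin : {x | A.dom x}.Finite) {x y : M}
include hA hfin

theorem IsOrdered.rank_lt (hx : A.dom x) (hy : A.dom y) (h : A.lt x y) :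
    A.rank x < A.rank y := by
  refine Set.ncard_lt_ncard ⟨fun z hz => ⟨hz.1, hA.2.1 z hz.1 x hx y hy hz.2 h⟩, fun hs => ?_⟩
    (hfin.subset fun z hz => hz.1)
  exact hA.1 x hx (hs ⟨hx, h⟩).2

theorem IsOrdered.rank_succ (hx : A.dom x) (hy : A.dom y) (h : A.succ x y) :
    A.rank y = A.rank x + 1 := by
  obtain ⟨hxy, hm⟩ := hA.2.2.1 x hx y hy h
  have : {z | A.dom z ∧ A.lt z y} = insert x {z | A.dom z ∧ A.lt z x} := by
    ext z
    constructor
    · rintro ⟨hz, hzy⟩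
      rcases hm z hz hzy with h | rfl
      · exact .inr ⟨hz, h⟩
      · exact .inl rfl
    · rintro (rfl | ⟨hz, hzx⟩)
      · exact ⟨hx, hxy⟩
      · exact ⟨hz, hA.2.1 z hz x hx y hy hzx hxy⟩
  rw [rank, this, Set.ncard_insert_of_notMem (fun h => hA.1 x hx h.2)
    (hfin.subset fun z hz => hz.1), rank]

omit hfin in
theorem IsOrdered.rank_zero (hx : A.dom x) (h : A.zero x) : A.rank x = 0 := by
  have : {z | A.dom z ∧ A.lt z x} = ∅ :=
    Set.eq_empty_of_forall_notMem fun z hz => hA.2.2.2 x hx h z hz.1 hz.2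
  rw [rank, this, Set.ncard_empty]

end Rank

/-- `Nat.pair` enumerates the shells of constant `max a b`: first the pairs with `a < b` by
increasing `a`, then those with `b ≤ a` by increasing `b`, then the next shell. -/
theorem unpair_pair_add_one (a b : ℕ) : Nat.unpair (Nat.pair a b + 1) =
    if a < b then if a + 1 < b then (a + 1, b) else (b, 0)
    else if b < a then (a, b + 1) else (0, a + 1) := by
  have key : ∀ p : ℕ × ℕ, Nat.pair p.1 p.2 = Nat.pair a b + 1 →
      Nat.unpair (Nat.pair a b + 1) = p := fun p hp => by rw [← hp, Nat.unpair_pair]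
  apply key
  split_ifs with h₁ h₂ h₂
  · simp only [Nat.pair, if_pos h₁, if_pos h₂]; ring
  · obtain rfl : b = a + 1 := by lia
    simp [Nat.pair]; ring
  · have : ¬ a < b + 1 := by lia
    simp only [Nat.pair, if_neg h₁, if_neg this]; ring
  · obtain rfl : a = b := by lia
    simp [Nat.pair]; ring

/-- Induction on the rank of `z`. Both components go together, since each is justified by both
components of the predecessor. -/
theorem rank_unpair (hA : A.IsOrdered) (hfin : {x | A.dom x}.Finite) (hl : A.UnpairsLeft)
    (hr : A.UnpairsRight) (m : ℕ) : ∀ z, A.dom z → A.rank z = m → ∀ c, A.dom c →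
      (A.left z c → A.rank c = m.unpair.1) ∧ (A.right z c → A.rank c = m.unpair.2) := by
  induction m with
  | zero =>
    refine fun z hz hm c hc => ⟨fun h => ?_, fun h => ?_⟩
    · rcases hl z hz c hc h with ⟨-, h0⟩ | ⟨z', hz', -, -, -, -, hs, -⟩
      · simp [hA.rank_zero hc h0]
      · have := hA.rank_succ hfin hz' hz hs
        lia
    · rcases hr z hz c hc h with ⟨-, h0⟩ | ⟨z', hz', -, -, -, -, hs, -⟩
      · simp [hA.rank_zero hc h0]
      · have := hA.rank_succ hfin hz' hz hs
        lia
  | succ m ih =>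
    refine fun z hz hm c hc => ⟨fun h => ?_, fun h => ?_⟩
    · rcases hl z hz c hc h with ⟨h0, -⟩ | ⟨z', hz', a, ha, b, hb, hs, hla, hrb, h⟩
      · simp [hA.rank_zero hz h0] at hm
      · have hs := hA.rank_succ hfin hz' hz hs
        have h1 := (ih z' hz' (by lia) a ha).1 hla
        have h2 := (ih z' hz' (by lia) b hb).2 hrb
        rw [← Nat.pair_unpair m, unpair_pair_add_one, ← h1, ← h2]
        rcases h with ⟨h, h'⟩ | ⟨h, rfl⟩ | ⟨rfl, h⟩
        · have h := hA.rank_lt hfin ha hb h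
          have h' := hA.rank_succ hfin ha hc h'
          split_ifs <;> simp only <;> lia
        · have h := hA.rank_lt hfin hb hc h
          rw [if_neg (by lia), if_pos h]
        · simp [hA.rank_zero hc h]
    · rcases hr z hz c hc h with ⟨h0, -⟩ | ⟨z', hz', a, ha, b, hb, hs, hla, hrb, h⟩
      · simp [hA.rank_zero hz h0] at hm
      · have hs := hA.rank_succ hfin hz' hz hs
        have h1 := (ih z' hz' (by lia) a ha).1 hla
        have h2 := (ih z' hz' (by lia) b hb).2 hrb
        rw [← Nat.pair_unpair m, unpair_pair_add_one, ← h1, ← h2]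
        rcases h with ⟨h, ⟨h', h0⟩ | ⟨a', ha', h', h'', rfl⟩⟩ | ⟨h, h'⟩ | ⟨rfl, h⟩
        · have h' := hA.rank_succ hfin ha hb h'
          rw [if_pos (by lia), if_neg (by lia), hA.rank_zero hc h0]
        · have h := hA.rank_lt hfin ha hc h
          have h' := hA.rank_succ hfin ha ha' h'
          have h'' := hA.rank_lt hfin ha' hc h''
          rw [if_pos h, if_pos (by lia)]
        · have h := hA.rank_lt hfin hb ha h
          have h' := hA.rank_succ hfin hb hc h'
          rw [if_neg (by lia), if_pos h, h']
        · simp [hA.rank_succ hfin ha hc h]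

/-- Stage `k + l + 1` dominates both given stages; the extra unit is spent on the recursive call of
`evaln`. -/
theorem mem_eval_rfind'_of_ne_zero {f : Code} {a m r y : ℕ} (hr : r ∈ f.eval (Nat.pair a m))
    (h0 : r ≠ 0) (hy : y ∈ (Code.rfind' f).eval (Nat.pair a (m + 1))) :
    y ∈ (Code.rfind' f).eval (Nat.pair a m) := by
  obtain ⟨k, hk⟩ := Code.evaln_complete.1 hr
  obtain ⟨l, hl⟩ := Code.evaln_complete.1 hy
  refine Code.evaln_sound (k := k + l + 1) ?_
  simp only [Code.evaln, Nat.unpaired, Nat.unpair_pair, Option.mem_def, bind,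
    Option.bind_eq_some_iff, Option.guard_eq_some', pure]
  refine ⟨(), ?_, r, Code.evaln_mono (by lia) hk, ?_⟩
  · have := Code.evaln_bound hk
    lia
  · rw [if_neg h0]
    exact Code.evaln_mono (by lia) hl

theorem mem_eval_rfind'_of_zero {f : Code} {a m : ℕ} (hr : 0 ∈ f.eval (Nat.pair a m)) :
    m ∈ (Code.rfind' f).eval (Nat.pair a m) := by
  obtain ⟨k, hk⟩ := Code.evaln_complete.1 hr
  refine Code.evaln_sound (k := k + 1) ?_
  simp only [Code.evaln, Nat.unpaired, Nat.unpair_pair, Option.mem_def, bind,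
    Option.bind_eq_some_iff, Option.guard_eq_some', pure]
  refine ⟨(), ?_, 0, Code.evaln_mono (by lia) hk, ?_⟩
  · have := Code.evaln_bound hk
    lia
  · rw [if_pos rfl]

/-- Induction on the code, with an inner induction where a code justifies its own entries. For
`prec` the counter decreases. For `rfind'` it increases, but as a rank it is bounded by the size of
the finite domain, so circular justifications are impossible. -/
theorem Evaluates.mem_eval (hA : A.IsOrdered) (hfin : {x | A.dom x}.Finite) (hl : A.UnpairsLeft)
    (hr : A.UnpairsRight) {c : Code} (hc : A.Evaluates c) {x y : M} (hx : A.dom x) (hy : A.dom y)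
    (h : A.val c x y) : A.rank y ∈ c.eval (A.rank x) := by
  have left : ∀ {z c}, A.dom z → A.dom c → A.left z c → A.rank c = (A.rank z).unpair.1 :=
    fun hz hc => (rank_unpair hA hfin hl hr _ _ hz rfl _ hc).1
  have right : ∀ {z c}, A.dom z → A.dom c → A.right z c → A.rank c = (A.rank z).unpair.2 :=
    fun hz hc => (rank_unpair hA hfin hl hr _ _ hz rfl _ hc).2
  have pair : ∀ {z a b}, A.dom z → A.dom a → A.dom b → A.left z a → A.right z b →
      A.rank z = Nat.pair (A.rank a) (A.rank b) := fun hz ha hb h h' => by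
    rw [left hz ha h, right hz hb h', Nat.pair_unpair]
  induction c generalizing x y with
  | zero => simp [Code.eval, pure, PFun.pure, hA.rank_zero hy (hc x hx y hy h)]
  | succ => simp [Code.eval, hA.rank_succ hfin hx hy (hc x hx y hy h)]
  | left => simp [Code.eval, left hx hy (hc x hx y hy h)]
  | right => simp [Code.eval, right hx hy (hc x hx y hy h)]
  | pair f g ihf ihg =>
    obtain ⟨hf, hg, hc⟩ := hc
    obtain ⟨u, hu, w, hw, h1, h2, h3, h4⟩ := hc x hx y hy h
    rw [pair hy hu hw h3 h4]
    simp only [Code.eval, Seq.seq, Part.map_eq_map, Part.mem_bind_iff, Part.mem_map_iff]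
    exact ⟨_, ⟨_, ihf hf hx hu h1, rfl⟩, _, ihg hg hx hw h2, rfl⟩
  | comp f g ihf ihg =>
    obtain ⟨hf, hg, hc⟩ := hc
    obtain ⟨u, hu, h1, h2⟩ := hc x hx y hy h
    exact Part.mem_bind (ihg hg hx hu h1) (ihf hf hu hy h2)
  | prec f g ihf ihg =>
    obtain ⟨hf, hg, hc⟩ := hc
    obtain ⟨k, hk⟩ : ∃ k, k = (A.rank x).unpair.2 := ⟨_, rfl⟩
    induction k generalizing x y with
    | zero =>
      obtain ⟨a, ha, m, hm, h1, h2, ⟨h3, h4⟩ | ⟨m', hm', -, -, -, -, -, -, -, -, h3, -⟩⟩ :=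
        hc x hx y hy h
      · rw [pair hx ha hm h1 h2, hA.rank_zero hm h3, Code.eval_prec_zero]
        exact ihf hf ha hy h4
      · have := right hx hm h2
        have := hA.rank_succ hfin hm' hm h3
        lia
    | succ k ih =>
      obtain ⟨a, ha, m, hm, h1, h2, ⟨h3, h4⟩ | ⟨m', hm', x', hx', i, hi, w, hw, q, hq,
        h3, h4, h5, h6, h7, h8, h9, h10, h11⟩⟩ := hc x hx y hy h
      · have := right hx hm h2
        have := hA.rank_zero hm h3
        lia
      · have e1 := right hx hm h2
        have e2 := hA.rank_succ hfin hm' hm h3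
        have e3 := ih hx' hi h6 (by rw [← right hx' hm' h5]; lia)
        have e4 := ihg hg hw hy h11
        rw [pair hx' ha hm' h4 h5] at e3
        rw [pair hw ha hq h7 h8, pair hq hm' hi h9 h10] at e4
        rw [pair hx ha hm h1 h2, e2, ← Nat.succ_eq_add_one, Code.eval_prec_succ]
        exact Part.mem_bind e3 e4
  | rfind' f ihf =>
    obtain ⟨hf, hc⟩ := hc
    have bound : ∀ {z}, A.dom z → A.rank z ≤ {x | A.dom x}.ncard := fun _ =>
      Set.ncard_le_ncard (fun _ h => h.1) hfin
    obtain ⟨k, hk⟩ : ∃ k, k = {x | A.dom x}.ncard - (A.rank x).unpair.2 := ⟨_, rfl⟩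
    induction k using Nat.strong_induction_on generalizing x y with
    | _ k ih =>
      obtain ⟨r, hr', a, ha, m, hm, h1, h2, h3, ⟨h4, rfl⟩ | ⟨r', hr'', m', hm', x', hx',
        h4, h5, h6, h7, h8⟩⟩ := hc x hx y hy h
      · have e1 := ihf hf hx hr' h1
        rw [hA.rank_zero hr' h4] at e1
        rw [pair hx ha hm h2 h3] at e1 ⊢
        exact mem_eval_rfind'_of_zero e1
      · have e1 := ihf hf hx hr' h1
        have e2 := hA.rank_succ hfin hm hm' h5
        have e3 := right hx hm h3
        have e4 := right hx' hm' h7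
        have e5 := bound hm'
        have e6 := ih _ (by lia) hx' hy h8 rfl
        rw [pair hx' ha hm' h6 h7, e2] at e6
        rw [pair hx ha hm h2 h3] at e1 ⊢
        exact mem_eval_rfind'_of_ne_zero e1 (by rw [hA.rank_succ hfin hr'' hr' h4]; lia) e6

theorem Verifies.dom_eval {c : Code} (h : A.Verifies c) (hfin : {x | A.dom x}.Finite) {x : M}
    (hx : A.dom x) (hi : A.input x) : (c.eval (A.rank x)).Dom := by
  obtain ⟨hA, hl, hr, hc, hv⟩ := h
  obtain ⟨y, hy, hxy⟩ := hv x hx hi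
  exact Part.dom_iff_mem.2 ⟨_, hc.mem_eval hA hfin hl hr hx hy hxy⟩

/-! ### Completeness: true arithmetic on an initial segment passes the check -/

variable (A) in
/-- `v` identifies `A.dom` with the numbers below `N`, and the arithmetic of `A` is true. -/
structure IsInitialSegment (N : ℕ) (v : M → ℕ) : Prop where
  lt_of_dom : ∀ x, A.dom x → v x < N
  exists_dom : ∀ m < N, ∃ x, A.dom x ∧ v x = m
  inj : ∀ x, A.dom x → ∀ y, A.dom y → v x = v y → x = y
  zero_iff : ∀ x, A.dom x → (A.zero x ↔ v x = 0)
  lt_iff : ∀ x, A.dom x → ∀ y, A.dom y → (A.lt x y ↔ v x < v y)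
  succ_iff : ∀ x, A.dom x → ∀ y, A.dom y → (A.succ x y ↔ v y = v x + 1)
  left_iff : ∀ x, A.dom x → ∀ y, A.dom y → (A.left x y ↔ v y = (v x).unpair.1)
  right_iff : ∀ x, A.dom x → ∀ y, A.dom y → (A.right x y ↔ v y = (v x).unpair.2)

namespace IsInitialSegment

variable {N : ℕ} {v : M → ℕ} (h : A.IsInitialSegment N v)
include h

theorem isOrdered : A.IsOrdered := by
  refine ⟨fun x hx => ?_, fun x hx y hy z hz => ?_, fun x hx y hy => ?_, fun x hx h0 y hy => ?_⟩
  · simp [h.lt_iff x hx x hx]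
  · rw [h.lt_iff x hx y hy, h.lt_iff y hy z hz, h.lt_iff x hx z hz]
    exact lt_trans
  · rw [h.lt_iff x hx y hy, h.succ_iff x hx y hy]
    refine fun hs => ⟨by lia, fun z hz hzy => ?_⟩
    rw [h.lt_iff z hz y hy] at hzy
    rw [h.lt_iff z hz x hx]
    rcases lt_or_eq_of_le (show v z ≤ v x by lia) with h' | h'
    · exact .inl h'
    · exact .inr (h.inj z hz x hx h')
  · rw [h.lt_iff y hy x hx, (h.zero_iff x hx).1 h0]
    lia

theorem exists_pred {z : M} (hz : A.dom z) (hne : v z ≠ 0) : ∃ z', A.dom z' ∧ ∃ a, A.dom a ∧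
    ∃ b, A.dom b ∧ A.succ z' z ∧ A.left z' a ∧ A.right z' b ∧
      v z = Nat.pair (v a) (v b) + 1 := by
  have hzN := h.lt_of_dom z hz
  obtain ⟨z', hz', e⟩ := h.exists_dom (v z - 1) (by lia)
  obtain ⟨a, ha, ea⟩ := h.exists_dom (v z').unpair.1
    (lt_of_le_of_lt (Nat.unpair_left_le _) (by lia))
  obtain ⟨b, hb, eb⟩ := h.exists_dom (v z').unpair.2
    (lt_of_le_of_lt (Nat.unpair_right_le _) (by lia))
  refine ⟨z', hz', a, ha, b, hb, (h.succ_iff _ hz' _ hz).2 (by lia), (h.left_iff _ hz' _ ha).2 ea,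
    (h.right_iff _ hz' _ hb).2 eb, ?_⟩
  rw [ea, eb, Nat.pair_unpair]
  lia

theorem unpairsLeft : A.UnpairsLeft := by
  intro z hz c hc hzc
  rw [h.left_iff z hz c hc] at hzc
  by_cases hz0 : v z = 0
  · exact .inl ⟨(h.zero_iff z hz).2 hz0, (h.zero_iff c hc).2 (by simp [hzc, hz0])⟩
  · obtain ⟨z', hz', a, ha, b, hb, h1, h2, h3, e⟩ := h.exists_pred hz hz0
    refine .inr ⟨z', hz', a, ha, b, hb, h1, h2, h3, ?_⟩
    rw [e, unpair_pair_add_one] at hzc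
    rw [h.lt_iff a ha b hb, h.lt_iff b hb a ha, h.succ_iff a ha c hc, h.zero_iff c hc]
    split_ifs at hzc with h4 h5 h5
    · exact .inl ⟨h4, hzc⟩
    · exact .inl ⟨h4, by simp only at hzc; lia⟩
    · exact .inr (.inl ⟨h5, h.inj _ hc _ ha hzc⟩)
    · exact .inr (.inr ⟨h.inj _ ha _ hb (by lia), hzc⟩)

theorem unpairsRight : A.UnpairsRight := by
  intro z hz c hc hzc
  rw [h.right_iff z hz c hc] at hzc
  by_cases hz0 : v z = 0
  · exact .inl ⟨(h.zero_iff z hz).2 hz0, (h.zero_iff c hc).2 (by simp [hzc, hz0])⟩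
  · obtain ⟨z', hz', a, ha, b, hb, h1, h2, h3, e⟩ := h.exists_pred hz hz0
    refine .inr ⟨z', hz', a, ha, b, hb, h1, h2, h3, ?_⟩
    rw [e, unpair_pair_add_one] at hzc
    rw [h.lt_iff a ha b hb, h.lt_iff b hb a ha, h.succ_iff a ha c hc, h.zero_iff c hc,
      h.succ_iff a ha b hb, h.succ_iff b hb c hc]
    split_ifs at hzc with h4 h5 h5
    · obtain ⟨a', ha', ea'⟩ := h.exists_dom (v a + 1) (h5.trans (h.lt_of_dom b hb))
      exact .inl ⟨h4, .inr ⟨a', ha', (h.succ_iff a ha a' ha').2 ea',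
        (h.lt_iff a' ha' b hb).2 (by lia), h.inj _ hc _ hb hzc⟩⟩
    · exact .inl ⟨h4, .inl ⟨by lia, hzc⟩⟩
    · exact .inr (.inl ⟨h5, hzc⟩)
    · exact .inr (.inr ⟨h.inj _ ha _ hb (by lia), hzc⟩)

end IsInitialSegment

/-- At stage `k` only arguments below `k` have values, so there are finitely many values. -/
theorem exists_evaln_lt (c : Code) (k : ℕ) : ∃ N, ∀ x y, y ∈ Code.evaln k c x → y < N := by
  refine ⟨(Finset.range k).sup (fun x => (Code.evaln k c x).getD 0) + 1, fun x y h => ?_⟩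
  have := Finset.le_sup (f := fun x => (Code.evaln k c x).getD 0)
    (Finset.mem_range.2 (Code.evaln_bound h))
  rw [Option.mem_def] at h
  simp only [h, Option.getD_some] at this
  lia

/-- The graphs of `Code.evaln (k + 1)`, restricted to a large initial segment of `ℕ`, justify each
other. -/
theorem exists_evaluates (k : ℕ) (c : Code) : ∃ N₀, k + 1 ≤ N₀ ∧
    ∀ (A : Arith M) (N : ℕ) (v : M → ℕ),
    N₀ ≤ N → A.IsInitialSegment N v →
    (∀ f, encode f ≤ encode c → ∀ x, A.dom x → ∀ y, A.dom y →
      (A.val f x y ↔ v y ∈ Code.evaln (k + 1) f (v x))) → A.Evaluates c := by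
  induction c with
  | zero =>
    refine ⟨k + 1, le_rfl, fun A N v hN hA hv x hx y hy h => ?_⟩
    have := (hv _ le_rfl x hx y hy).1 h
    simp only [Code.evaln, Option.mem_def, bind, Option.bind_eq_some_iff, Option.guard_eq_some', pure,
      Option.some.injEq] at this
    exact (hA.zero_iff y hy).2 (by tauto)
  | succ =>
    refine ⟨k + 1, le_rfl, fun A N v hN hA hv x hx y hy h => ?_⟩
    have := (hv _ le_rfl x hx y hy).1 h
    simp only [Code.evaln, Option.mem_def, bind, Option.bind_eq_some_iff, Option.guard_eq_some', pure,
      Option.some.injEq] at this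
    exact (hA.succ_iff x hx y hy).2 (by grind)
  | left =>
    refine ⟨k + 1, le_rfl, fun A N v hN hA hv x hx y hy h => ?_⟩
    have := (hv _ le_rfl x hx y hy).1 h
    simp only [Code.evaln, Option.mem_def, bind, Option.bind_eq_some_iff, Option.guard_eq_some', pure,
      Option.some.injEq] at this
    exact (hA.left_iff x hx y hy).2 (by grind)
  | right =>
    refine ⟨k + 1, le_rfl, fun A N v hN hA hv x hx y hy h => ?_⟩
    have := (hv _ le_rfl x hx y hy).1 h
    simp only [Code.evaln, Option.mem_def, bind, Option.bind_eq_some_iff, Option.guard_eq_some', pure,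
      Option.some.injEq] at this
    exact (hA.right_iff x hx y hy).2 (by grind)
  | pair f g ihf ihg =>
    obtain ⟨N₁, hk, H₁⟩ := ihf
    obtain ⟨N₂, -, H₂⟩ := ihg
    have lt := Code.encode_lt_pair f g
    refine ⟨max N₁ N₂, by lia, fun A N v hN hA hv =>
      ⟨H₁ A N v (by lia) hA fun f' h => hv f' (by lia),
      H₂ A N v (by lia) hA fun f' h => hv f' (by lia), fun x hx y hy h => ?_⟩⟩
    have := (hv _ le_rfl x hx y hy).1 h
    simp only [Code.evaln, Option.mem_def, bind, Option.bind_eq_some_iff, Option.guard_eq_some',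
      Seq.seq, Option.map_eq_map, Option.map_eq_some_iff] at this
    obtain ⟨-, -, -, ⟨m, hm, rfl⟩, l, hl, hml⟩ := this
    have hyN := hA.lt_of_dom y hy
    have h1 := Nat.left_le_pair m l
    have h2 := Nat.right_le_pair m l
    obtain ⟨u, hu, rfl⟩ := hA.exists_dom m (by lia)
    obtain ⟨w, hw, rfl⟩ := hA.exists_dom l (by lia)
    refine ⟨u, hu, w, hw, (hv f lt.1.le x hx u hu).2 hm, (hv g lt.2.le x hx w hw).2 hl,
      (hA.left_iff y hy u hu).2 ?_, (hA.right_iff y hy w hw).2 ?_⟩ <;> simp [← hml]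
  | comp f g ihf ihg =>
    obtain ⟨N₁, hk, H₁⟩ := ihf
    obtain ⟨N₂, -, H₂⟩ := ihg
    have lt := Code.encode_lt_comp f g
    refine ⟨max N₁ N₂, by lia, fun A N v hN hA hv =>
      ⟨H₁ A N v (by lia) hA fun f' h => hv f' (by lia),
      H₂ A N v (by lia) hA fun f' h => hv f' (by lia), fun x hx y hy h => ?_⟩⟩
    have := (hv _ le_rfl x hx y hy).1 h
    simp only [Code.evaln, Option.mem_def, bind, Option.bind_eq_some_iff, Option.guard_eq_some'] at this
    obtain ⟨-, -, m, hm, hmy⟩ := this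
    -- The intermediate value is itself an argument at stage `k + 1`, hence at most `k`.
    obtain ⟨u, hu, rfl⟩ := hA.exists_dom m (by have := Code.evaln_bound hmy; lia)
    exact ⟨u, hu, (hv g lt.2.le x hx u hu).2 hm, (hv f lt.1.le u hu y hy).2 hmy⟩
  | prec f g ihf ihg =>
    obtain ⟨N₁, hk, H₁⟩ := ihf
    obtain ⟨N₂, -, H₂⟩ := ihg
    have lt := Code.encode_lt_prec f g
    refine ⟨max N₁ N₂, by lia, fun A N v hN hA hv =>
      ⟨H₁ A N v (by lia) hA fun f' h => hv f' (by lia),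
      H₂ A N v (by lia) hA fun f' h => hv f' (by lia), fun x hx y hy h => ?_⟩⟩
    have hxy := (hv _ le_rfl x hx y hy).1 h
    have hxN := hA.lt_of_dom x hx
    obtain ⟨a, ha, ea⟩ := hA.exists_dom (v x).unpair.1
      (lt_of_le_of_lt (Nat.unpair_left_le _) hxN)
    obtain ⟨m, hm, em⟩ := hA.exists_dom (v x).unpair.2
      (lt_of_le_of_lt (Nat.unpair_right_le _) hxN)
    refine ⟨a, ha, m, hm, (hA.left_iff x hx a ha).2 ea, (hA.right_iff x hx m hm).2 em, ?_⟩
    simp only [Code.evaln, Option.mem_def, bind, Option.bind_eq_some_iff, Option.guard_eq_some',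
      Nat.unpaired, ← ea, ← em] at hxy
    obtain ⟨-, -, hxy⟩ := hxy
    have hmN := hA.lt_of_dom m hm
    obtain hm0 | ⟨m₀, hm₀⟩ : v m = 0 ∨ ∃ m₀, v m = m₀ + 1 := by
      cases v m <;> simp
    · rw [hm0] at hxy
      exact .inl ⟨(hA.zero_iff m hm).2 hm0, (hv f lt.1.le a ha y hy).2 hxy⟩
    · rw [hm₀] at hxy
      simp only [Option.bind_eq_some_iff] at hxy
      obtain ⟨i, hi, hiy⟩ := hxy
      have b1 := Code.evaln_bound hi
      have b2 := Code.evaln_bound hiy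
      have b3 := Nat.right_le_pair (v a) (Nat.pair m₀ i)
      have b4 := Nat.right_le_pair m₀ i
      obtain ⟨m', hm', rfl⟩ := hA.exists_dom m₀ (by lia)
      obtain ⟨x', hx', ex'⟩ := hA.exists_dom (Nat.pair (v a) (v m')) (by lia)
      obtain ⟨w, hw, ew⟩ := hA.exists_dom _ (show Nat.pair (v a) (Nat.pair (v m') i) < N by lia)
      obtain ⟨q, hq, eq⟩ := hA.exists_dom (Nat.pair (v m') i) (by lia)
      obtain ⟨i, hi', rfl⟩ := hA.exists_dom i (by lia)
      rw [← ex'] at hi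
      rw [← ew] at hiy
      -- The recursive call runs at stage `k`; monotonicity lifts it to the common stage of all
      -- tables.
      refine .inr ⟨m', hm', x', hx', i, hi', w, hw, q, hq, (hA.succ_iff m' hm' m hm).2 hm₀,
        (hA.left_iff x' hx' a ha).2 (by simp [ex']), (hA.right_iff x' hx' m' hm').2 (by simp [ex']),
        (hv _ le_rfl x' hx' i hi').2 (Code.evaln_mono k.le_succ hi),
        (hA.left_iff w hw a ha).2 (by simp [ew]), (hA.right_iff w hw q hq).2 (by simp [ew, eq]),
        (hA.left_iff q hq m' hm').2 (by simp [eq]), (hA.right_iff q hq i hi').2 (by simp [eq]),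
        (hv g lt.2.le w hw y hy).2 hiy⟩
  | rfind' f ihf =>
    obtain ⟨N₁, hk, H₁⟩ := ihf
    -- The search discards the value `r` of `f`: it is neither a later argument nor part of `y`, so
    -- it needs a bound of its own.
    obtain ⟨N₂, H₂⟩ := exists_evaln_lt f (k + 1)
    have lt := Code.encode_lt_rfind' f
    refine ⟨max N₁ N₂, by lia, fun A N v hN hA hv =>
      ⟨H₁ A N v (by lia) hA fun f' h => hv f' (by lia),
      fun x hx y hy h => ?_⟩⟩
    have hxy := (hv _ le_rfl x hx y hy).1 h
    have hxN := hA.lt_of_dom x hx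
    obtain ⟨a, ha, ea⟩ := hA.exists_dom (v x).unpair.1
      (lt_of_le_of_lt (Nat.unpair_left_le _) hxN)
    obtain ⟨m, hm, em⟩ := hA.exists_dom (v x).unpair.2
      (lt_of_le_of_lt (Nat.unpair_right_le _) hxN)
    simp only [Code.evaln, Option.mem_def, bind, Option.bind_eq_some_iff, Option.guard_eq_some', pure,
      Nat.unpaired, ← ea, ← em] at hxy
    obtain ⟨-, -, r, hr, hxy⟩ := hxy
    have hrN := H₂ _ _ hr
    rw [ea, em, Nat.pair_unpair] at hr
    obtain ⟨r, hr', rfl⟩ := hA.exists_dom r (by lia)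
    refine ⟨r, hr', a, ha, m, hm, (hv f lt.le x hx r hr').2 hr, (hA.left_iff x hx a ha).2 ea,
      (hA.right_iff x hx m hm).2 em, ?_⟩
    have hrN := hA.lt_of_dom r hr'
    split_ifs at hxy with h0
    · exact .inl ⟨(hA.zero_iff r hr').2 h0, hA.inj _ hy _ hm (Option.some.inj hxy).symm⟩
    · have b1 := Code.evaln_bound hxy
      have b2 := Nat.right_le_pair (v a) (v m + 1)
      obtain ⟨r', hr'', er⟩ := hA.exists_dom (v r - 1) (by lia)
      obtain ⟨m', hm', em'⟩ := hA.exists_dom (v m + 1) (by lia)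
      obtain ⟨x', hx', ex'⟩ := hA.exists_dom (Nat.pair (v a) (v m + 1)) (by lia)
      rw [← ex'] at hxy
      exact .inr ⟨r', hr'', m', hm', x', hx', (hA.succ_iff _ hr'' _ hr').2 (by lia),
        (hA.succ_iff _ hm _ hm').2 em', (hA.left_iff _ hx' _ ha).2 (by simp [ex']),
        (hA.right_iff _ hx' _ hm').2 (by simp [ex', em']),
        (hv _ le_rfl x' hx' y hy).2 (Code.evaln_mono k.le_succ hxy)⟩

end Arith

end Arithmetic

/-! ### Definability in expansions of betweenness structures -/

section Definability

open FirstOrder FirstOrder.Language Encodable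

variable {n : ℕ} {ι : Type} {T : Set (EuclideanSpace ℝ (Fin n))} {k : ℕ}

/-- Truth of a first-order formula in the expansion `(T, β, (Pᵢ))`. -/
def Satisfies (P : ι → Set T) (φ : (monadicLanguage ι).BoundedFormula Empty k)
    (v : Fin k → T) : Prop :=
  @BoundedFormula.Realize (monadicLanguage ι) T (expansion T P) Empty k φ default v

theorem holds_iff_satisfies (P : ι → Set T) (φ : (monadicLanguage ι).Sentence) :
    Holds T P φ ↔ Satisfies P φ default :=
  Iff.rfl

theorem satisfies_imp {P : ι → Set T} {φ ψ : (monadicLanguage ι).BoundedFormula Empty k}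
    {v : Fin k → T} : Satisfies P (φ.imp ψ) v ↔ (Satisfies P φ v → Satisfies P ψ v) :=
  Iff.rfl

theorem satisfies_falsum {P : ι → Set T} {v : Fin k → T} :
    Satisfies P (.falsum : (monadicLanguage ι).BoundedFormula Empty k) v ↔ False :=
  Iff.rfl

theorem satisfies_all {P : ι → Set T} {φ : (monadicLanguage ι).BoundedFormula Empty (k + 1)}
    {v : Fin k → T} : Satisfies P φ.all v ↔ ∀ x, Satisfies P φ (Fin.snoc v x) :=
  Iff.rfl

/-- The atomic formula `x ∈ Pᵢ`. -/
def memFormula (i : ι) (x : Fin k) : (monadicLanguage ι).BoundedFormula Empty k :=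
  .rel (l := 1) (MonadicRel.pred i) fun _ => .var (.inr x)

/-- The atomic formula `β(x, y, z)`. -/
def betwFormula (x y z : Fin k) : (monadicLanguage ι).BoundedFormula Empty k :=
  .rel (l := 3) MonadicRel.betw fun j => .var (.inr (![x, y, z] j))

/-- The formula saying that `x`, `y`, `z` are collinear. -/
def collinearFormula (x y z : Fin k) : (monadicLanguage ι).BoundedFormula Empty k :=
  ((betwFormula x y z).imp .falsum).imp
    (((betwFormula x z y).imp .falsum).imp (betwFormula y x z))

theorem satisfies_memFormula {P : ι → Set T} {i : ι} {x : Fin k} {v : Fin k → T} :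
    Satisfies P (memFormula i x) v ↔ v x ∈ P i :=
  Iff.rfl

theorem satisfies_betwFormula {P : ι → Set T} {x y z : Fin k} {v : Fin k → T} :
    Satisfies P (betwFormula x y z) v ↔ Betw (v x : EuclideanSpace ℝ (Fin n)) (v y) (v z) :=
  Iff.rfl

theorem satisfies_collinearFormula {P : ι → Set T} {x y z : Fin k} {v : Fin k → T} :
    Satisfies P (collinearFormula x y z) v ↔
      CollinearTriple (v x : EuclideanSpace ℝ (Fin n)) (v y) (v z) := by
  simp only [collinearFormula, satisfies_imp, satisfies_betwFormula, satisfies_falsum,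
    CollinearTriple]
  tauto

/-- A property of `k` points of `T`, depending on unary predicates, is definable if it is defined
by a first-order formula. -/
def IsDefinable (Q : (ι → Set T) → (Fin k → T) → Prop) : Prop :=
  ∃ φ : (monadicLanguage ι).BoundedFormula Empty k, ∀ P v, Satisfies P φ v ↔ Q P v

def IsVariable (f : (Fin k → T) → T) : Prop :=
  ∃ i, ∀ v, f v = v i

theorem isVariable_apply (i : Fin k) : IsVariable fun v : Fin k → T => v i :=
  ⟨i, fun _ => rfl⟩

theorem IsVariable.init {f : (Fin k → T) → T} (hf : IsVariable f) :
    IsVariable fun v : Fin (k + 1) → T => f (Fin.init v) :=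
  let ⟨i, hi⟩ := hf
  ⟨i.castSucc, fun v => hi (Fin.init v)⟩

namespace IsDefinable

variable {Q R : (ι → Set T) → (Fin k → T) → Prop}

theorem imp (hQ : IsDefinable Q) (hR : IsDefinable R) : IsDefinable fun P v => Q P v → R P v := by
  obtain ⟨φ, hφ⟩ := hQ
  obtain ⟨ψ, hψ⟩ := hR
  exact ⟨φ.imp ψ, fun P v => by rw [satisfies_imp, hφ, hψ]⟩

theorem not (hQ : IsDefinable Q) : IsDefinable fun P v => ¬ Q P v :=
  hQ.imp ⟨.falsum, fun _ _ => satisfies_falsum⟩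

theorem and (hQ : IsDefinable Q) (hR : IsDefinable R) : IsDefinable fun P v => Q P v ∧ R P v := by
  obtain ⟨φ, hφ⟩ := (hQ.imp hR.not).not
  exact ⟨φ, fun P v => by rw [hφ]; tauto⟩

theorem or (hQ : IsDefinable Q) (hR : IsDefinable R) : IsDefinable fun P v => Q P v ∨ R P v := by
  obtain ⟨φ, hφ⟩ := hQ.not.imp hR
  exact ⟨φ, fun P v => by rw [hφ]; tauto⟩

theorem all {Q : (ι → Set T) → (Fin k → T) → T → Prop}
    (hQ : IsDefinable fun P (v : Fin (k + 1) → T) => Q P (Fin.init v) (v (Fin.last k))) :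
    IsDefinable fun P v => ∀ x, Q P v x := by
  obtain ⟨φ, hφ⟩ := hQ
  refine ⟨φ.all, fun P v => ?_⟩
  simp only [satisfies_all, hφ, Fin.init_snoc, Fin.snoc_last]

theorem ex {Q : (ι → Set T) → (Fin k → T) → T → Prop}
    (hQ : IsDefinable fun P (v : Fin (k + 1) → T) => Q P (Fin.init v) (v (Fin.last k))) :
    IsDefinable fun P v => ∃ x, Q P v x := by
  obtain ⟨φ, hφ⟩ := (all (Q := fun P v x => ¬ Q P v x) hQ.not).not
  exact ⟨φ, fun P v => by rw [hφ]; push Not; rfl⟩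

variable {f g h : (Fin k → T) → T}

theorem eq (hf : IsVariable f) (hg : IsVariable g) :
    IsDefinable fun (_ : ι → Set T) v => f v = g v := by
  obtain ⟨i, hi⟩ := hf
  obtain ⟨j, hj⟩ := hg
  exact ⟨.equal (.var (.inr i)) (.var (.inr j)), fun P v => by simp only [hi, hj]; rfl⟩

theorem mem (i : ι) (hf : IsVariable f) :
    IsDefinable fun (P : ι → Set T) v => f v ∈ P i := by
  obtain ⟨j, hj⟩ := hf
  exact ⟨memFormula i j, fun P v => by simp only [hj, satisfies_memFormula]⟩

theorem collinearTriple (hf : IsVariable f) (hg : IsVariable g) (hh : IsVariable h) :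
    IsDefinable fun (_ : ι → Set T) v =>
      CollinearTriple (f v : EuclideanSpace ℝ (Fin n)) (g v) (h v) := by
  obtain ⟨i, hi⟩ := hf
  obtain ⟨j, hj⟩ := hg
  obtain ⟨l, hl⟩ := hh
  exact ⟨collinearFormula i j l, fun P v => by
    simp only [hi, hj, hl, satisfies_collinearFormula]⟩

end IsDefinable

/-- The binary relation that a set `X` of points encodes, given two centres `a` and `b`: the point
where the lines `ax` and `by` meet is in `X`. -/
def Related (a b : T) (X : Set T) (x y : T) : Prop :=
  ∃ r, r ∈ X ∧ CollinearTriple (a : EuclideanSpace ℝ (Fin n)) x r ∧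
    CollinearTriple (b : EuclideanSpace ℝ (Fin n)) y r

/-- The arithmetic encoded by finite sets `P (ρ 0)`, `P (ρ 1)`, … of points. -/
def arithOfSets (ρ : ℕ → ι) (P : ι → Set T) (a b : T) : Arith T where
  dom x := x ∈ P (ρ 0)
  zero x := x ∈ P (ρ 1)
  input x := x ∈ P (ρ 2)
  lt := Related a b (P (ρ 3))
  succ := Related a b (P (ρ 4))
  left := Related a b (P (ρ 5))
  right := Related a b (P (ρ 6))
  val c := Related a b (P (ρ (7 + encode c)))

namespace IsDefinable

variable {f g : (Fin k → T) → T} {a b : (Fin k → T) → T} {ρ : ℕ → ι}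

theorem related (i : ι) (ha : IsVariable a) (hb : IsVariable b) (hf : IsVariable f)
    (hg : IsVariable g) : IsDefinable fun P v => Related (a v) (b v) (P i) (f v) (g v) :=
  ex (and (mem i (isVariable_apply _)) (and (collinearTriple ha.init hf.init (isVariable_apply _))
    (collinearTriple hb.init hg.init (isVariable_apply _))))

theorem arith_dom (hf : IsVariable f) :
    IsDefinable fun P v => (arithOfSets ρ P (a v) (b v)).dom (f v) :=
  mem _ hf

theorem arith_zero (hf : IsVariable f) :
    IsDefinable fun P v => (arithOfSets ρ P (a v) (b v)).zero (f v) :=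
  mem _ hf

theorem arith_input (hf : IsVariable f) :
    IsDefinable fun P v => (arithOfSets ρ P (a v) (b v)).input (f v) :=
  mem _ hf

variable (ha : IsVariable a) (hb : IsVariable b) (hf : IsVariable f) (hg : IsVariable g)
include ha hb hf hg

theorem arith_lt : IsDefinable fun P v => (arithOfSets ρ P (a v) (b v)).lt (f v) (g v) :=
  related _ ha hb hf hg

theorem arith_succ : IsDefinable fun P v => (arithOfSets ρ P (a v) (b v)).succ (f v) (g v) :=
  related _ ha hb hf hg

theorem arith_left : IsDefinable fun P v => (arithOfSets ρ P (a v) (b v)).left (f v) (g v) :=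
  related _ ha hb hf hg

theorem arith_right : IsDefinable fun P v => (arithOfSets ρ P (a v) (b v)).right (f v) (g v) :=
  related _ ha hb hf hg

theorem arith_val (c : Nat.Partrec.Code) :
    IsDefinable fun P v => (arithOfSets ρ P (a v) (b v)).val c (f v) (g v) :=
  related _ ha hb hf hg

end IsDefinable

/-! ### Definability of the check -/

section Verifies

variable {ρ : ℕ → ι}

theorem isDefinable_evaluates (c : Nat.Partrec.Code) :
    IsDefinable fun (P : ι → Set T) (v : Fin 2 → T) =>
      (arithOfSets ρ P (v 0) (v 1)).Evaluates c := by
  induction c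
  all_goals
    simp only [Arith.Evaluates]
    -- Subcodes are handled by `assumption`; the anonymous constructor proves the `IsVariable`
    -- goals.
    repeat' first
      | assumption
      | exact ⟨_, fun _ => rfl⟩
      | apply IsDefinable.arith_dom
      | apply IsDefinable.arith_zero
      | apply IsDefinable.arith_succ
      | apply IsDefinable.arith_left
      | apply IsDefinable.arith_right
      | apply IsDefinable.arith_val
      | apply IsDefinable.eq
      | apply IsDefinable.and
      | apply IsDefinable.or
      | apply IsDefinable.imp
      | apply IsDefinable.all
      | apply IsDefinable.ex

theorem isDefinable_verifies (c : Nat.Partrec.Code) :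
    IsDefinable fun (P : ι → Set T) (v : Fin 2 → T) =>
      (arithOfSets ρ P (v 0) (v 1)).Verifies c := by
  have hc := isDefinable_evaluates (T := T) (ρ := ρ) c
  unfold Arith.Verifies Arith.IsOrdered Arith.UnpairsLeft Arith.UnpairsRight Arith.HasValue
  repeat' first
    | assumption
    | exact ⟨_, fun _ => rfl⟩
    | apply IsDefinable.arith_dom
    | apply IsDefinable.arith_zero
    | apply IsDefinable.arith_input
    | apply IsDefinable.arith_lt
    | apply IsDefinable.arith_succ
    | apply IsDefinable.arith_left
    | apply IsDefinable.arith_right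
    | apply IsDefinable.arith_val
    | apply IsDefinable.eq
    | apply IsDefinable.and
    | apply IsDefinable.or
    | apply IsDefinable.not
    | apply IsDefinable.imp
    | apply IsDefinable.all
    | apply IsDefinable.ex

end Verifies

end Definability

/-! ### Reducing the halting problem -/

section Reduction

open FirstOrder FirstOrder.Language Encodable Nat.Partrec

/-! ### Locating a number by a chain of successors -/

namespace Arith

variable {M : Type*} {A : Arith M}

variable (A) in
/-- No chain of `j` successors leads from `y` to an input. -/
def Misses : ℕ → M → Prop
  | 0, y => ¬ A.input y
  | j + 1, y => ∀ y', A.dom y' → A.succ y y' → Misses j y'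

/-- The sum of the rank and the number of remaining steps is constant along a chain, so an input at
its end would have a rank on which `c` halts. -/
theorem Verifies.misses {c : Code} (h : A.Verifies c) (hfin : {x | A.dom x}.Finite) {j : ℕ} {y : M}
    (hy : A.dom y) (hj : ¬ (c.eval (A.rank y + j)).Dom) : A.Misses j y := by
  induction j generalizing y with
  | zero => exact fun hi => hj (h.dom_eval hfin hy hi)
  | succ j ih =>
    intro y' hy' hs
    refine ih hy' ?_
    rwa [h.1.rank_succ hfin hy hy' hs, add_assoc, add_comm 1]

theorem IsInitialSegment.not_misses {N : ℕ} {v : M → ℕ} (h : A.IsInitialSegment N v) {j : ℕ} {y : M}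
    (hy : A.dom y) (hN : v y + j < N) (hi : ∀ x, A.dom x → v x = v y + j → A.input x) :
    ¬ A.Misses j y := by
  induction j generalizing y with
  | zero => exact fun hm => hm (hi y hy rfl)
  | succ j ih =>
    intro hm
    obtain ⟨y', hy', e⟩ := h.exists_dom (v y + 1) (by lia)
    exact ih hy' (by lia) (fun x hx hxy => hi x hx (by lia))
      (hm y' hy' ((h.succ_iff y hy y' hy').2 e))

end Arith

variable {n : ℕ} {ι : Type} {T : Set (EuclideanSpace ℝ (Fin n))}

/-! ### The reduction sentence -/

section Formulas

variable (ρ : ℕ → ι)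

/-- The formula, with free variables `a`, `b`, … and `y` (the last one), saying that no chain of `j`
successors leads from `y` to an input. -/
def missesFormula : (j k : ℕ) → (monadicLanguage ι).BoundedFormula Empty (k + 3)
  | 0, k => (memFormula (ρ 2) (Fin.last (k + 2))).imp .falsum
  -- The quantifiers bind a point coding a successor pair, then the successor; hence `k` grows by 2.
  -- Variables are numbered from the outside in, so 0 and 1 remain the centres.
  | j + 1, k => .all <| .all <|
    (memFormula (ρ 4) (⟨k + 3, by lia⟩ : Fin (k + 5))).imp <|
    (memFormula (ρ 0) ⟨k + 4, by lia⟩).imp <|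
    (collinearFormula ⟨0, by lia⟩ ⟨k + 2, by lia⟩ ⟨k + 3, by lia⟩).imp <|
    (collinearFormula ⟨1, by lia⟩ ⟨k + 4, by lia⟩ ⟨k + 3, by lia⟩).imp <|
    missesFormula j (k + 2)

theorem satisfies_missesFormula (P : ι → Set T) (j k : ℕ) (v : Fin (k + 3) → T) :
    Satisfies P (missesFormula ρ j k) v ↔
      (arithOfSets ρ P (v ⟨0, by lia⟩) (v ⟨1, by lia⟩)).Misses j (v (Fin.last (k + 2))) := by
  induction j generalizing k with
  | zero => rfl
  | succ j ih =>
    have e : ∀ (r y' : T), ∀ i (hi : i < k + 3),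
        Fin.snoc (α := fun _ => T) (Fin.snoc (α := fun _ => T) v r) y' (⟨i, by lia⟩ : Fin (k + 5)) =
          v ⟨i, hi⟩ := fun r y' i hi => by
      have : i < k + 3 + 1 := by lia
      simp [Fin.snoc, hi, this]
    have e₁ : ∀ (r y' : T), Fin.snoc (α := fun _ => T) (Fin.snoc (α := fun _ => T) v r) y'
        (⟨k + 3, by lia⟩ : Fin (k + 5)) = r := fun r y' => by simp [Fin.snoc]
    have e₂ : ∀ (r y' : T), Fin.snoc (α := fun _ => T) (Fin.snoc (α := fun _ => T) v r) y'
        (⟨k + 4, by lia⟩ : Fin (k + 5)) = y' := fun r y' => by simp [Fin.snoc]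
    have e₃ : ∀ (r y' : T), Fin.snoc (α := fun _ => T) (Fin.snoc (α := fun _ => T) v r) y'
        (Fin.last (k + 2 + 2)) = y' := fun r y' => e₂ r y'
    simp only [missesFormula, satisfies_all, satisfies_imp, satisfies_memFormula,
      satisfies_collinearFormula, ih]
    simp only [e₁, e₂, e₃, e _ _ 0 (by lia), e _ _ 1 (by lia), e _ _ (k + 2) (by lia)]
    exact ⟨fun h y' hy' ⟨r, hr, h₁, h₂⟩ => h r y' hr hy' h₁ h₂,
      fun h r y' hr hy' h₁ h₂ => h y' hy' ⟨r, hr, h₁, h₂⟩⟩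

/-- The sentence saying that in no arithmetic that satisfies `χ` the number `x` is an input. -/
def reductionSentence (χ : (monadicLanguage ι).BoundedFormula Empty 2) (x : ℕ) :
    (monadicLanguage ι).Sentence :=
  .all <| .all <| χ.imp <| .all <|
    (memFormula (ρ 1) (2 : Fin 3)).imp <| (memFormula (ρ 0) (2 : Fin 3)).imp <|
      missesFormula ρ x 0

theorem holds_reductionSentence {χ : (monadicLanguage ι).BoundedFormula Empty 2} {c : Code}
    (hχ : ∀ (P : ι → Set T) v, Satisfies P χ v ↔ (arithOfSets ρ P (v 0) (v 1)).Verifies c)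
    (P : ι → Set T) (x : ℕ) : Holds T P (reductionSentence ρ χ x) ↔
      ∀ a b : T, (arithOfSets ρ P a b).Verifies c → ∀ y, (arithOfSets ρ P a b).zero y →
        (arithOfSets ρ P a b).dom y → (arithOfSets ρ P a b).Misses x y := by
  simp only [holds_iff_satisfies, reductionSentence, satisfies_all, satisfies_imp, hχ,
    satisfies_memFormula, satisfies_missesFormula]
  rfl

end Formulas

/-! ### Computability of Gödel numbers -/

section Codes

theorem primrec_betwCode {α : Type*} [Primcodable α] {f g h : α → ℕ} (hf : Primrec f)
    (hg : Primrec g) (hh : Primrec h) :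
    Primrec fun x => Nat.pair 2 (Nat.pair (f x) (Nat.pair (g x) (h x))) :=
  Primrec₂.natPair.comp (.const 2) (Primrec₂.natPair.comp hf (Primrec₂.natPair.comp hg hh))

theorem primrec_impCode {α : Type*} [Primcodable α] {f g : α → ℕ} (hf : Primrec f)
    (hg : Primrec g) : Primrec fun x => Nat.pair 4 (Nat.pair (f x) (g x)) :=
  Primrec₂.natPair.comp (.const 4) (Primrec₂.natPair.comp hf hg)

theorem primrec_allCode {α : Type*} [Primcodable α] {f : α → ℕ} (hf : Primrec f) :
    Primrec fun x => Nat.pair 5 (f x) :=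
  Primrec₂.natPair.comp (.const 5) hf

theorem primrec_memCode {α : Type*} [Primcodable α] (i : ℕ) {f : α → ℕ} (hf : Primrec f) :
    Primrec fun x => Nat.pair 3 (Nat.pair i (f x)) :=
  Primrec₂.natPair.comp (.const 3) (Primrec₂.natPair.comp (.const i) hf)

/-- The Gödel number of `collinearFormula x y z`. -/
def collinearCode (x y z : ℕ) : ℕ :=
  Nat.pair 4 (Nat.pair
    (Nat.pair 4 (Nat.pair (Nat.pair 2 (Nat.pair x (Nat.pair y z))) (Nat.pair 0 0)))
    (Nat.pair 4 (Nat.pair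
      (Nat.pair 4 (Nat.pair (Nat.pair 2 (Nat.pair x (Nat.pair z y))) (Nat.pair 0 0)))
      (Nat.pair 2 (Nat.pair y (Nat.pair x z))))))

theorem primrec_collinearCode {α : Type*} [Primcodable α] {f g h : α → ℕ} (hf : Primrec f)
    (hg : Primrec g) (hh : Primrec h) : Primrec fun x => collinearCode (f x) (g x) (h x) :=
  primrec_impCode (primrec_impCode (primrec_betwCode hf hg hh) (.const _))
    (primrec_impCode (primrec_impCode (primrec_betwCode hf hh hg) (.const _))
      (primrec_betwCode hg hf hh))

variable (ν : ι → ℕ) (ρ : ℕ → ι)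

/-- The Gödel number of `missesFormula ρ (j + 1) k`, given that of `missesFormula ρ j (k + 2)`. -/
def missesCodeStep (s₀ s₄ k r : ℕ) : ℕ :=
  Nat.pair 5 <| Nat.pair 5 <|
    Nat.pair 4 <| Nat.pair (Nat.pair 3 (Nat.pair s₄ (k + 3))) <|
    Nat.pair 4 <| Nat.pair (Nat.pair 3 (Nat.pair s₀ (k + 4))) <|
    Nat.pair 4 <| Nat.pair (collinearCode 0 (k + 2) (k + 3)) <|
    Nat.pair 4 <| Nat.pair (collinearCode 1 (k + 4) (k + 3)) r

theorem formulaCode_missesFormula_succ (j k : ℕ) :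
    formulaCode ν (missesFormula ρ (j + 1) k) =
      missesCodeStep (ν (ρ 0)) (ν (ρ 4)) k (formulaCode ν (missesFormula ρ j (k + 2))) :=
  rfl

theorem primrec_missesCodeStep {α : Type*} [Primcodable α] (s₀ s₄ : ℕ) {f g : α → ℕ}
    (hf : Primrec f) (hg : Primrec g) : Primrec fun x => missesCodeStep s₀ s₄ (f x) (g x) := by
  have add : ∀ m, Primrec fun x => f x + m := fun m => Primrec.nat_add.comp hf (.const m)
  exact primrec_allCode <| primrec_allCode <|
    primrec_impCode (primrec_memCode _ (add 3)) <|
    primrec_impCode (primrec_memCode _ (add 4)) <|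
    primrec_impCode (primrec_collinearCode (.const 0) (add 2) (add 3)) <|
    primrec_impCode (primrec_collinearCode (.const 1) (add 4) (add 3)) hg

/-- The recursion for `missesFormula` moves `k` along with `j`. Building outwards from the innermost
formula, where `k = 2 * x`, makes `k` a function of the stage and leaves an ordinary primitive
recursion. -/
theorem formulaCode_missesFormula (x i : ℕ) (hi : i ≤ x) :
    formulaCode ν (missesFormula ρ i (2 * (x - i))) =
      Nat.rec (formulaCode ν (missesFormula ρ 0 (2 * x)))
        (fun i r => missesCodeStep (ν (ρ 0)) (ν (ρ 4)) (2 * (x - (i + 1))) r) i := by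
  induction i with
  | zero => rfl
  | succ i ih =>
    rw [formulaCode_missesFormula_succ, show 2 * (x - (i + 1)) + 2 = 2 * (x - i) by lia,
      ih (by lia)]

theorem primrec_formulaCode_missesFormula :
    Primrec fun x => formulaCode ν (missesFormula ρ x 0) := by
  have h0 : Primrec fun x => formulaCode ν (missesFormula ρ 0 (2 * x)) :=
    primrec_impCode (primrec_memCode _
      (Primrec.nat_add.comp (Primrec.nat_mul.comp (.const 2) .id) (.const 2))) (.const _)
  have h1 : Primrec₂ fun (x : ℕ) (p : ℕ × ℕ) =>
      missesCodeStep (ν (ρ 0)) (ν (ρ 4)) (2 * (x - (p.1 + 1))) p.2 :=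
    primrec_missesCodeStep _ _
      (Primrec.nat_mul.comp (.const 2) (Primrec.nat_sub.comp .fst
        (Primrec.succ.comp (Primrec.fst.comp .snd)))) (Primrec.snd.comp .snd)
  refine (Primrec.nat_rec' Primrec.id h0 h1).of_eq fun x => ?_
  have := formulaCode_missesFormula ν ρ x x le_rfl
  rw [show 2 * (x - x) = 0 by lia] at this
  exact this.symm

/-- Since `χ` does not depend on `x`, its code is a constant, even though `χ` is only known to
exist. -/
theorem primrec_formulaCode_reductionSentence (χ : (monadicLanguage ι).BoundedFormula Empty 2) :
    Primrec fun x => formulaCode ν (reductionSentence ρ χ x) :=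
  primrec_allCode <| primrec_allCode <| primrec_impCode (.const _) <| primrec_allCode <|
    primrec_impCode (.const _) <| primrec_impCode (.const _) <|
      primrec_formulaCode_missesFormula ν ρ

end Codes

/-- In a grid, every relation on the indices is encoded by a finite set. -/
theorem exists_finite_related {N : ℕ} {a b : T} {d : Fin N → T} {g : Fin N → Fin N → T}
    (ha : ∀ i j k, CollinearTriple (a : EuclideanSpace ℝ (Fin n)) (d k) (g i j) ↔ k = i)
    (hb : ∀ i j k, CollinearTriple (b : EuclideanSpace ℝ (Fin n)) (d k) (g i j) ↔ k = j)
    (R : ℕ → ℕ → Prop) :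
    ∃ X : Set T, X.Finite ∧ ∀ i j, Related a b X (d i) (d j) ↔ R i j := by
  refine ⟨{p | ∃ i j : Fin N, R i j ∧ g i j = p}, ?_, fun i j => ⟨?_, fun h => ?_⟩⟩
  · refine (Set.finite_range fun q : Fin N × Fin N => g q.1 q.2).subset ?_
    rintro _ ⟨i, j, -, rfl⟩
    exact ⟨(i, j), rfl⟩
  · rintro ⟨_, ⟨i', j', h, rfl⟩, h₁, h₂⟩
    rwa [(ha _ _ _).1 h₁, (hb _ _ _).1 h₂]
  · exact ⟨g i j, ⟨i, j, h, rfl⟩, (ha _ _ _).2 rfl, (hb _ _ _).2 rfl⟩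

/-! ### Realizing arithmetic in a grid -/

theorem ExtendsLinearly.exists_arith (hT : ExtendsLinearly 2 T) (ν : ι → ℕ) (ρ : ℕ → ι) (K N x : ℕ)
    (hνρ : ∀ i < 7 + K, ν (ρ i) = i) (F : Code → ℕ → ℕ → Prop) :
    ∃ (P : ι → Set T) (a b : T) (v : T → ℕ), (∀ i, (P i).Finite) ∧
      (arithOfSets ρ P a b).IsInitialSegment N v ∧
      (∀ p, (arithOfSets ρ P a b).dom p → ((arithOfSets ρ P a b).input p ↔ v p = x)) ∧
      ∀ c, encode c < K → ∀ p, (arithOfSets ρ P a b).dom p → ∀ q, (arithOfSets ρ P a b).dom q →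
        ((arithOfSets ρ P a b).val c p q ↔ F c (v p) (v q)) := by
  obtain ⟨a, b, d, g, ha, hb⟩ := hT.exists_grid N
  have dinj : Function.Injective d := fun i j h => (ha j j i).1 (h ▸ (ha j j j).2 rfl)
  choose X hXf hX using exists_finite_related ha hb
  -- The default value 0 off the grid line is harmless: all requirements on `v` concern the domain.
  set v : T → ℕ := Function.extend d (fun i => (i : ℕ)) 0
  have vd : ∀ i, v (d i) = i := fun i => dinj.extend_apply _ _ i
  set Y : ℕ → Set T := fun i => match i with
    | 0 => Set.range d
    | 1 => {p | ∃ i : Fin N, (i : ℕ) = 0 ∧ d i = p}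
    | 2 => {p | ∃ i : Fin N, (i : ℕ) = x ∧ d i = p}
    | 3 => X fun i j => i < j
    | 4 => X fun i j => j = i + 1
    | 5 => X fun i j => j = i.unpair.1
    | 6 => X fun i j => j = i.unpair.2
    | i + 7 => X (F (Denumerable.ofNat Code i))
  have hYρ : ∀ i < 7 + K, Y (ν (ρ i)) = Y i := fun i hi => by rw [hνρ i hi]
  have dom : ∀ p, p ∈ Y (ν (ρ 0)) ↔ ∃ i, d i = p := fun p => by
    rw [hYρ 0 (by lia)]; rfl
  refine ⟨fun i => Y (ν i), a, b, v, fun i => ?_, ⟨?_, ?_, ?_, ?_, ?_, ?_, ?_, ?_⟩, ?_, ?_⟩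
  · have sub : ∀ Q : Fin N → Prop, {p | ∃ i, Q i ∧ d i = p}.Finite := fun Q =>
      (Set.finite_range d).subset fun p ⟨i, _, h⟩ => ⟨i, h⟩
    show (Y (ν i)).Finite
    generalize ν i = m
    match m with
    | 0 => exact Set.finite_range d
    | 1 => exact sub _
    | 2 => exact sub _
    | 3 => exact hXf _
    | 4 => exact hXf _
    | 5 => exact hXf _
    | 6 => exact hXf _
    | i + 7 => exact hXf _
  · intro p hp
    obtain ⟨i, rfl⟩ := (dom p).1 hp
    rw [vd]; exact i.is_lt
  · intro m hm
    exact ⟨d ⟨m, hm⟩, (dom _).2 ⟨_, rfl⟩, vd _⟩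
  · intro p hp q hq h
    obtain ⟨i, rfl⟩ := (dom p).1 hp
    obtain ⟨j, rfl⟩ := (dom q).1 hq
    rw [vd, vd] at h
    rw [Fin.ext h]
  · intro p hp
    obtain ⟨i, rfl⟩ := (dom p).1 hp
    show d i ∈ Y (ν (ρ 1)) ↔ _
    rw [hYρ 1 (by lia), vd]
    exact ⟨fun ⟨j, hj, h⟩ => dinj h ▸ hj, fun h => ⟨i, h, rfl⟩⟩
  · intro p hp q hq
    obtain ⟨i, rfl⟩ := (dom p).1 hp
    obtain ⟨j, rfl⟩ := (dom q).1 hq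
    show Related a b (Y (ν (ρ 3))) _ _ ↔ _
    rw [hYρ 3 (by lia), vd, vd]
    exact hX _ i j
  · intro p hp q hq
    obtain ⟨i, rfl⟩ := (dom p).1 hp
    obtain ⟨j, rfl⟩ := (dom q).1 hq
    show Related a b (Y (ν (ρ 4))) _ _ ↔ _
    rw [hYρ 4 (by lia), vd, vd]
    exact hX _ i j
  · intro p hp q hq
    obtain ⟨i, rfl⟩ := (dom p).1 hp
    obtain ⟨j, rfl⟩ := (dom q).1 hq
    show Related a b (Y (ν (ρ 5))) _ _ ↔ _
    rw [hYρ 5 (by lia), vd, vd]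
    exact hX _ i j
  · intro p hp q hq
    obtain ⟨i, rfl⟩ := (dom p).1 hp
    obtain ⟨j, rfl⟩ := (dom q).1 hq
    show Related a b (Y (ν (ρ 6))) _ _ ↔ _
    rw [hYρ 6 (by lia), vd, vd]
    exact hX _ i j
  · intro p hp
    obtain ⟨i, rfl⟩ := (dom p).1 hp
    show d i ∈ Y (ν (ρ 2)) ↔ _
    rw [hYρ 2 (by lia), vd]
    exact ⟨fun ⟨j, hj, h⟩ => dinj h ▸ hj, fun h => ⟨i, h, rfl⟩⟩
  · intro c hc p hp q hq
    obtain ⟨i, rfl⟩ := (dom p).1 hp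
    obtain ⟨j, rfl⟩ := (dom q).1 hq
    show Related a b (Y (ν (ρ (7 + encode c)))) _ _ ↔ _
    rw [hYρ _ (by lia), vd, vd, add_comm 7]
    rw [show Y (encode c + 7) = X (F (Denumerable.ofNat Code (encode c))) from rfl,
      Denumerable.ofNat_encode]
    exact hX _ i j

theorem ExtendsLinearly.exists_verifies (hT : ExtendsLinearly 2 T) (ν : ι → ℕ) (ρ : ℕ → ι)
    (c : Code) (hνρ : ∀ i < 7 + (encode c + 1), ν (ρ i) = i) {x : ℕ} (hx : (c.eval x).Dom) :
    ∃ (P : ι → Set T) (a b : T), (∀ i, (P i).Finite) ∧ (arithOfSets ρ P a b).Verifies c ∧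
      ∃ y, (arithOfSets ρ P a b).zero y ∧ (arithOfSets ρ P a b).dom y ∧
        ¬ (arithOfSets ρ P a b).Misses x y := by
  obtain ⟨y, hy⟩ := Part.dom_iff_mem.1 hx
  obtain ⟨k, hk⟩ := Code.evaln_complete.1 hy
  obtain ⟨N₀, hkN, hN₀⟩ := Arith.exists_evaluates (M := T) k c
  have hxk := Code.evaln_bound hk
  -- The segment must also contain the value `y`; it contains the input because `x < k < N₀`.
  obtain ⟨P, a, b, v, hP, hA, hinput, hval⟩ := hT.exists_arith ν ρ (encode c + 1)
    (max N₀ (y + 1)) x hνρ fun f i j => j ∈ Code.evaln (k + 1) f i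
  refine ⟨P, a, b, hP, ⟨hA.isOrdered, hA.unpairsLeft, hA.unpairsRight,
    hN₀ _ _ v (le_max_left _ _) hA fun f hf => hval f (by lia), fun p hp hpi => ?_⟩, ?_⟩
  · obtain ⟨q, hq, hqy⟩ := hA.exists_dom y (by lia)
    refine ⟨q, hq, (hval c (by lia) p hp q hq).2 ?_⟩
    rw [(hinput p hp).1 hpi, hqy]
    exact Code.evaln_mono k.le_succ hk
  · obtain ⟨z, hz, hz0⟩ := hA.exists_dom 0 (by lia)
    refine ⟨z, (hA.zero_iff z hz).2 hz0, hz, hA.not_misses hz (by lia) fun p hp hpx => ?_⟩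
    exact (hinput p hp).2 (by lia)

/-- Leaving `ι`, `ν` and `ρ` open lets one argument serve both finitely many set variables and the
predicates indexed by `ℕ`. -/
theorem ExtendsLinearly.exists_reduction (hT : ExtendsLinearly 2 T) (ν : ι → ℕ) (ρ : ℕ → ι)
    (c : Code) (hνρ : ∀ i < 7 + (encode c + 1), ν (ρ i) = i) :
    ∃ f : ℕ → (monadicLanguage ι).Sentence, Computable (fun x => formulaCode ν (f x)) ∧
      ∀ x, (∀ P : ι → Set T, (∀ i, (P i).Finite) → Holds T P (f x)) ↔ ¬ (c.eval x).Dom := by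
  obtain ⟨χ, hχ⟩ := isDefinable_verifies (T := T) (ρ := ρ) c
  refine ⟨reductionSentence ρ χ, (primrec_formulaCode_reductionSentence ν ρ χ).to_comp,
    fun x => ⟨fun h hx => ?_, fun hx P hP => ?_⟩⟩
  · obtain ⟨P, a, b, hP, hv, y, hy0, hy, hm⟩ := hT.exists_verifies ν ρ c hνρ hx
    exact hm ((holds_reductionSentence ρ hχ P x).1 (h P hP) a b hv y hy0 hy)
  · rw [holds_reductionSentence ρ hχ]
    intro a b hv y hy0 hy
    refine hv.misses (hP _) hy ?_
    rwa [hv.1.rank_zero hy hy0, zero_add]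

/-! ### Hardness and undecidability of the two theories -/

theorem exists_code_dom_iff {p : ℕ → Prop} (hp : REPred p) :
    ∃ c : Code, ∀ x, (c.eval x).Dom ↔ p x := by
  have : Nat.Partrec fun x => (Part.assert (p x) fun _ => Part.some ()).map encode := by
    have h : Nat.Partrec _ := hp
    simpa using h
  obtain ⟨c, hc⟩ := Code.exists_code.1 this
  exact ⟨c, fun x => by rw [hc]; simp [Part.assert]⟩

theorem ExtendsLinearly.piZeroOneHard_weakMonadicPiTheory (hT : ExtendsLinearly 2 T) :
    PiZeroOneHard piSentenceCode (weakMonadicPiTheory T) := by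
  intro B hB
  obtain ⟨c, hc⟩ := exists_code_dom_iff hB
  set K := 7 + (encode c + 1)
  have hK : 0 < K := by lia
  -- Only indices below `K` matter, as subcodes have smaller codes than `c`; the remainder modulo
  -- `K` just makes `ρ` total.
  obtain ⟨f, hf, h⟩ := hT.exists_reduction (ι := Fin K) Fin.val (fun i => ⟨i % K, Nat.mod_lt _ hK⟩)
    c fun i hi => Nat.mod_eq_of_lt hi
  refine ⟨fun x => ⟨K, f x⟩, (Primrec₂.natPair.to_comp).comp (.const K) hf, fun x => ?_⟩
  rw [← not_not (a := B x), ← hc]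
  exact (h x).symm

theorem ExtendsLinearly.piZeroOneHard_finiteExpansionTheory (hT : ExtendsLinearly 2 T) :
    PiZeroOneHard sentenceCode (finiteExpansionTheory T) := by
  intro B hB
  obtain ⟨c, hc⟩ := exists_code_dom_iff hB
  obtain ⟨f, hf, h⟩ := hT.exists_reduction (ι := ℕ) id id c fun _ _ => rfl
  refine ⟨f, hf, fun x => ?_⟩
  rw [← not_not (a := B x), ← hc]
  exact (h x).symm

/-- The codes that do not halt on 0 form a set with recursively enumerable complement; a decision
procedure for `A` would decide it. -/
theorem PiZeroOneHard.not_decidableByCode {S : Type} {code : S → ℕ} {A : Set S}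
    (hA : PiZeroOneHard code A) : ¬ DecidableByCode code A := by
  rintro ⟨d, hd, hdA⟩
  obtain ⟨f, hf, h⟩ := hA (fun x => ¬ ((Denumerable.ofNat Code x).eval 0).Dom) (by
    simp only [not_not]
    exact (Code.eval_part.comp (Computable.ofNat Code) (Computable.const 0)).dom_re)
  refine ComputablePred.halting_problem 0 (ComputablePred.computable_iff.2
    ⟨fun c => !d (code (f (encode c))), ?_, ?_⟩)
  · exact Primrec.not.to_comp.comp (hd.comp (hf.comp Computable.encode))
  · funext c
    have := (h (encode c)).trans (hdA _)
    rw [Denumerable.ofNat_encode] at this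
    rw [eq_iff_iff, Bool.not_eq_true', ← Bool.not_eq_true, ← this, not_not]

end Reduction

end BetweennessTheories

theorem mainTheorem4 {n : ℕ} (T : Set (EuclideanSpace ℝ (Fin n)))
    (hT : BetweennessTheories.ExtendsLinearly 2 T) :
    BetweennessTheories.PiZeroOneHard BetweennessTheories.piSentenceCode
        (BetweennessTheories.weakMonadicPiTheory T) ∧
      ¬ BetweennessTheories.DecidableByCode BetweennessTheories.sentenceCode
        (BetweennessTheories.finiteExpansionTheory T) :=
  ⟨hT.piZeroOneHard_weakMonadicPiTheory,
    hT.piZeroOneHard_finiteExpansionTheory.not_decidableByCode⟩
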